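/- **Definitions.** A *net* is a tuple $N=(S,T,F,M_0)$ with disjoint sets $S$ (places) and $T$ (transitions), a flow function $F:(S\times T)\cup(T\times S)\to\mathbb N$ and an initial marking $M_0:S\to\mathbb N$, such that every $t\in T$ has a finite non-empty set of preplaces $\{s\mid F(s,t)>0\}$ and a finite set of postplaces $\{s\mid F(t,s)>0\}$. For a finite multiset $G$ of transitions let ${}^\bullet G(s)=\sum_t G(t)F(s,t)$ and $G^\bullet(s)=\sum_t G(t)F(t,s)$; write ${}^\bullet x(y)=F(y,x)$, $x^\bullet(y)=F(x,y)$. A non-empty finite $G$ is *enabled* in a marking $M$ if ${}^\bullet G\le M$, and then it leads to $(M-{}^\bullet G)+G^\bullet$; a marking is *reachable* if it is obtained from $M_0$ by firing finitely many single transitions. $G$ is *in conflict* in $M$ if for each $t\in G$ the restriction of $G$ to $\{t\}$ is enabled in $M$ but $G$ is not. $N$ is *conflict-free* if no non-empty finite multiset of transitions is in conflict in any reachable marking. $N$ is a *structural conflict net* if, whenever a two-element multiset $\{t,u\}$ of transitions (possibly $t=u$) is enabled in a reachable marking, ${}^\bullet t\cap{}^\bullet u=\emptyset$. A *(GR-)process*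 of $N$ is a pair $P=(\mathcal N,\pi)$ where $\mathcal N=(\mathcal S,\mathcal T,\mathcal F,\mathcal M_0)$ is a net with $|{}^\bullet s|\le 1\ge|s^\bullet|$ for all $s\in\mathcal S$, $\mathcal M_0(s)=1$ if ${}^\bullet s=\emptyset$ and $\mathcal M_0(s)=0$ otherwise, with $\mathcal F^+$ (the transitive closure of $\{(x,y)\mid \mathcal F(x,y)>0\}$) irreflexive and $\{t\in\mathcal T\mid (t,u)\in\mathcal F^+\}$ finite for all $u\in\mathcal T$; and $\pi:\mathcal S\cup\mathcal T\to S\cup T$ maps places to places and transitions to transitions, with $M_0(s)=|\pi^{-1}(s)\cap\mathcal M_0|$, $F(s,\pi(t))=|\pi^{-1}(s)\cap{}^\bullet t|$ and $F(\pi(t),s)=|\pi^{-1}(s)\cap t^\bullet|$ for all $s\in S$, $t\in\mathcal T$. $P$ is *finite* if $\mathcal T$ is finite. A process $P'$ is a *prefix* of $P$, written $P'\le P$, if $\mathcal S'\subseteq\mathcal S$, $\mathcal T'\subseteq\mathcal T$, $\mathcal M_0'=\mathcal M_0$, and $\mathcal F'$, $\pi'$ are the restrictions of $\mathcal F$, $\pi$.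 A process $P$ is *maximal* if there is no process $Q\ne P$ with $P\le Q$. For $p,q\in\mathcal S$ with $\pi(p)=\pi(q)$ and $(p,q),(q,p)\notin\mathcal F^+$, $\mathrm{swap}(P,p,q)$ is obtained from $P$ by exchanging the outgoing arcs of $p$ and $q$. Write $P\approx_s Q$ if some $\mathrm{swap}(P,p,q)$ is isomorphic to $Q$, let $\approx_s^*$ be the reflexive and transitive closure of $\approx_s$, and $[P]$ the $\approx_s^*$-class of a finite process $P$. Put $[P']\le[P]$ if $P'\approx_s^*Q'\le Q\approx_s^*P$ for some $Q',Q$. Write $P\approx_s^\infty Q$ (*swapping equivalence*) if $\downarrow\{[P']\mid P'\le P,\ P'\text{ finite}\}=\ \downarrow\{[Q']\mid Q'\le Q,\ Q'\text{ finite}\}$, where $\downarrow$ is prefix-closure under $\le$. A *BD-process* of $N$ is a $\approx_s^\infty$-equivalence class of processes; it is *weakly maximal* if it contains a maximal process. **Theorem.** Let $N$ be a (not necessarily countable) conflict-free structural conflict net. Then $N$ has exactly one weakly maximal BD-process; i.e. $N$ has a maximal GR-process, and any two maximal GR-processes of $N$ are related by $\approx_s^\infty$. -/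

import Mathlib

universe u

namespace PT

open Classical in
/-- The multiset `G ↾ {t}`, for a finite multiset `G`. -/
noncomputable def onlyAt {U : Type*} (G : Multiset U) (t : U) : Multiset U :=
  Multiset.replicate (G.count t) t

/-- A net (place/transition system) `(S, T, F, M₀)` of finite synchronisation, with arc weights,
whose places and transitions are elements of an ambient type `U`. The flow relation
`(S × T ∪ T × S) → ℕ` and the initial marking `S → ℕ` are extended by `0`. -/
structure Net (U : Type*) where
  /-- places -/
  S : Set U
  /-- transitions -/
  T : Set U
  /-- flow relation with arc weights -/
  F : U → U → ℕ
  /-- initial marking -/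
  M₀ : U → ℕ
  disjoint : Disjoint S T
  F_support : ∀ x y, F x y ≠ 0 → (x ∈ S ∧ y ∈ T) ∨ (x ∈ T ∧ y ∈ S)
  M₀_support : ∀ x, M₀ x ≠ 0 → x ∈ S
  pre_finite : ∀ t ∈ T, {s | 0 < F s t}.Finite
  pre_nonempty : ∀ t ∈ T, {s | 0 < F s t}.Nonempty
  post_finite : ∀ t ∈ T, {s | 0 < F t s}.Finite

namespace Net

variable {U : Type*} (N : Net U)

/-- `•G`, for a finite multiset `G`. -/
def pre (G : Multiset U) (s : U) : ℕ := (G.map fun t => N.F s t).sum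

/-- `G•`, for a finite multiset `G`. -/
def post (G : Multiset U) (s : U) : ℕ := (G.map fun t => N.F t s).sum

/-- `G` is a non-empty finite multiset of transitions with `•G ⊆ M`. -/
def Enabled (M : U → ℕ) (G : Multiset U) : Prop :=
  G ≠ 0 ∧ (∀ t ∈ G, t ∈ N.T) ∧ ∀ s, N.pre G s ≤ M s

/-- `G` is a step from `M` to `M'`: `G` is enabled in `M` and `M' = (M - •G) + G•`. -/
def Step (M : U → ℕ) (G : Multiset U) (M' : U → ℕ) : Prop :=
  N.Enabled M G ∧ ∀ s, M' s = (M s - N.pre G s) + N.post G s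

/-- `M` is reached from the initial marking by firing a (possibly empty) sequence of transitions. -/
def Reachable (M : U → ℕ) : Prop :=
  Relation.ReflTransGen (fun M₁ M₂ => ∃ t, N.Step M₁ {t} M₂) N.M₀ M

/-- The non-empty finite multiset `G` of transitions is in semantic conflict in `M`. -/
def InConflict (G : Multiset U) (M : U → ℕ) : Prop :=
  (∀ t ∈ G, N.Enabled M (onlyAt G t)) ∧ ¬ N.Enabled M G

/-- Semantic conflict-freeness. -/
def ConflictFree : Prop :=
  ∀ G : Multiset U, G ≠ 0 → (∀ t ∈ G, t ∈ N.T) → ∀ M, N.Reachable M → ¬ N.InConflict G M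

/-- Transitions that can occur together in one step (in a reachable marking) share no preplace. -/
def IsStructuralConflictNet : Prop :=
  ∀ t ∈ N.T, ∀ v ∈ N.T, (∃ M, N.Reachable M ∧ N.Enabled M {t, v}) →
    ∀ s, min (N.F s t) (N.F s v) = 0

/-- `F⁺`, the transitive closure of `{(x, y) | F(x, y) > 0}`. -/
def FPlus : U → U → Prop := Relation.TransGen fun x y => 0 < N.F x y

end Net

open Classical in
/-- A GR-process `(𝒩, π)` of a net `N`. The places and transitions of `𝒩` form arbitrary sets:
subclasses of the class `ZFSet.{u}` of all sets which are sets, that is `u`-small. -/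
structure GRProcess {U : Type u} (N : Net U) where
  net : Net ZFSet.{u}
  small_S : Small.{u} net.S
  small_T : Small.{u} net.T
  /-- `|•s| ≤ 1`: at most one ingoing arc. -/
  pre_place : ∀ s ∈ net.S, (∀ t, net.F t s ≤ 1) ∧ {t | 0 < net.F t s}.Subsingleton
  /-- `|s•| ≤ 1`: at most one outgoing arc. -/
  post_place : ∀ s ∈ net.S, (∀ t, net.F s t ≤ 1) ∧ {t | 0 < net.F s t}.Subsingleton
  init : ∀ s ∈ net.S, net.M₀ s = if ∀ t, net.F t s = 0 then 1 else 0
  acyclic : ∀ x, ¬ net.FPlus x x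
  finite_past : ∀ v ∈ net.T, {t | t ∈ net.T ∧ net.FPlus t v}.Finite
  /-- the process mapping -/
  π : ↥(net.S ∪ net.T) → U
  π_place : ∀ x : ↥(net.S ∪ net.T), x.1 ∈ net.S → π x ∈ N.S
  π_trans : ∀ x : ↥(net.S ∪ net.T), x.1 ∈ net.T → π x ∈ N.T
  π_init : ∀ s ∈ N.S,
    (N.M₀ s : ℕ∞) = {x : ↥(net.S ∪ net.T) | π x = s ∧ 0 < net.M₀ x}.encard
  π_pre : ∀ t : ↥(net.S ∪ net.T), t.1 ∈ net.T → ∀ s ∈ N.S,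
    (N.F s (π t) : ℕ∞) = {x : ↥(net.S ∪ net.T) | π x = s ∧ 0 < net.F x t}.encard
  π_post : ∀ t : ↥(net.S ∪ net.T), t.1 ∈ net.T → ∀ s ∈ N.S,
    (N.F (π t) s : ℕ∞) = {x : ↥(net.S ∪ net.T) | π x = s ∧ 0 < net.F t x}.encard

namespace GRProcess

variable {U : Type u} {N : Net U}

/-- `P` is finite if it has finitely many transitions. -/
def IsFinite (P : GRProcess N) : Prop := P.net.T.Finite

/-- `P' ≤ P`: `P'` is a prefix of `P`, and `P` an extension of `P'`. -/
def Prefix (P' P : GRProcess N) : Prop :=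
  P'.net.S ⊆ P.net.S ∧ P'.net.T ⊆ P.net.T ∧ P'.net.M₀ = P.net.M₀ ∧
  (∀ x y, (x ∈ P'.net.S ∧ y ∈ P'.net.T) ∨ (x ∈ P'.net.T ∧ y ∈ P'.net.S) →
    P'.net.F x y = P.net.F x y) ∧
  ∀ x (h' : x ∈ P'.net.S ∪ P'.net.T) (h : x ∈ P.net.S ∪ P.net.T), P'.π ⟨x, h'⟩ = P.π ⟨x, h⟩

/-- `P` is maximal: it has no proper extension. -/
def IsMaximal (P : GRProcess N) : Prop := ¬ ∃ Q : GRProcess N, P.Prefix Q ∧ Q ≠ P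

/-- Isomorphism of processes. -/
def Iso (P Q : GRProcess N) : Prop :=
  ∃ φ : ↥(P.net.S ∪ P.net.T) ≃ ↥(Q.net.S ∪ Q.net.T),
    (∀ x, (x.1 ∈ P.net.S ↔ (φ x).1 ∈ Q.net.S) ∧ (x.1 ∈ P.net.T ↔ (φ x).1 ∈ Q.net.T)) ∧
    (∀ x, Q.net.M₀ (φ x) = P.net.M₀ x) ∧
    (∀ x y, Q.net.F (φ x) (φ y) = P.net.F x y) ∧
    ∀ x, P.π x = Q.π (φ x)

open Classical in
/-- `R = swap(P, p, q)`, where `p`, `q` are causally unrelated places with the same image under the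
process mapping. -/
def IsSwap (P : GRProcess N) (p q : ZFSet.{u}) (R : GRProcess N) : Prop :=
  p ∈ P.net.S ∧ q ∈ P.net.S ∧ ¬ P.net.FPlus p q ∧ ¬ P.net.FPlus q p ∧
  (∀ hp hq, P.π ⟨p, hp⟩ = P.π ⟨q, hq⟩) ∧
  R.net.S = P.net.S ∧ R.net.T = P.net.T ∧ R.net.M₀ = P.net.M₀ ∧
  (∀ x h h', R.π ⟨x, h⟩ = P.π ⟨x, h'⟩) ∧
  ∀ x y, R.net.F x y =
    if x = p ∧ y ∈ P.net.T then P.net.F q y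
    else if x = q ∧ y ∈ P.net.T then P.net.F p y
    else P.net.F x y

/-- `P ≈ₛ Q`: one step swapping equivalence. -/
def OneStepSwapEquiv (P Q : GRProcess N) : Prop := ∃ p q R, P.IsSwap p q R ∧ R.Iso Q

/-- `P ≈ₛ* Q`: the reflexive and transitive closure of `≈ₛ`. -/
def SwapStar : GRProcess N → GRProcess N → Prop := Relation.ReflTransGen OneStepSwapEquiv

/-- The `≈ₛ*`-equivalence class of `P`. -/
def swapClass (P : GRProcess N) : Set (GRProcess N) := {Q | P.SwapStar Q}

/-- The prefix relation lifted to `≈ₛ*`-equivalence classes of finite processes. -/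
def ClassPrefix (A B : Set (GRProcess N)) : Prop :=
  ∃ P' P : GRProcess N, P'.IsFinite ∧ P.IsFinite ∧ A = P'.swapClass ∧ B = P.swapClass ∧
    ∃ Q' Q : GRProcess N, P'.SwapStar Q' ∧ Q'.Prefix Q ∧ Q.SwapStar P

/-- Prefix-closure `↓` of a set of `≈ₛ*`-equivalence classes of finite processes. -/
def prefixClosure (𝒜 : Set (Set (GRProcess N))) : Set (Set (GRProcess N)) :=
  {A | ∃ B ∈ 𝒜, ClassPrefix A B}

/-- The prefix-closure of the set of the classes of all finite prefixes of `P`. -/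
def BD (P : GRProcess N) : Set (Set (GRProcess N)) :=
  prefixClosure {A | ∃ P' : GRProcess N, P'.Prefix P ∧ P'.IsFinite ∧ A = P'.swapClass}

/-- `P ≈ₛ^∞ Q`: swapping equivalence. -/
def SwapEquiv (P Q : GRProcess N) : Prop := P.BD = Q.BD

/-- Swapping equivalence as a setoid. -/
def swapSetoid (N : Net U) : Setoid (GRProcess N) where
  r := SwapEquiv
  iseqv := ⟨fun _ => rfl, fun h => Eq.symm h, fun h h' => Eq.trans h h'⟩

end GRProcess

/-- A BD-process: a `≈ₛ^∞`-equivalence class of GR-processes. -/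
def BDProcess {U : Type u} (N : Net U) : Type (u + 1) := Quotient (GRProcess.swapSetoid N)

namespace BDProcess

variable {U : Type u} {N : Net U}

/-- The BD-process of a GR-process. -/
def mk (P : GRProcess N) : BDProcess N := Quotient.mk (GRProcess.swapSetoid N) P

/-- Some GR-process in the class is maximal. -/
def WeaklyMaximal (B : BDProcess N) : Prop := ∃ P : GRProcess N, mk P = B ∧ P.IsMaximal

end BDProcess

end PT

/-! The swapping equivalence class of a maximal process turns out to carry no information: its `BD`
is the set of classes of all finite processes of `N`, so any two maximal processes are equivalent
(`GRProcess.IsMaximal.BD_eq`). Existence of a maximal process is Zorn's lemma, the union of a chain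
being an upper bound.

What has to be shown is that every finite process embeds, up to swapping, into a finite prefix of a
given maximal process `Q` (`Proc.Maximal.exists_sub`). A finite process is built from its initial
places by appending transitions one at a time (`Proc.Ext`), so it suffices to absorb one appended
transition into `Q`. Let a finite process `p` be extended by a transition labelled `v`, with
preplaces `A`, and compare with another extension of `p`, by a transition labelled `w`. If `v = w`,
the two sets of preplaces have equally many places of each label, and swaps turn one into the other
(`Proc.Ext.star`). If `v ≠ w`, both transitions are enabled in the reachable marking at the end of
`p`; conflict-freeness enables them jointly, and the structural conflict condition makes their
preplaces disjoint, so that both can be appended (`Proc.Ext.diamond`).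

Hence along any chain of extensions the `v`-transition is either already present up to swapping or
can still be appended with the same preplaces `A` (`Proc.Ext.push`). If it were never absorbed by
finite prefixes of `Q`, no place of `A` would ever be consumed in `Q`, and `Q` could be extended,
against maximality (`Proc.Maximal.absorb`).

The argument runs on the presentation `Proc`, in which labels form a partial function and equality
of processes is plain extensionality. The maps `toGR` and `toProc` are mutually inverse and carry
the conclusion back. -/

namespace PT

open Relation

/-! ### Presentation of processes by sets and relations. -/

/-- A set-theoretic presentation of GR-processes: the flow relation is a plain relation, the labelling
is a partial function on the ambient universe, and the initial marking is left implicit. -/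
@[ext]
structure Proc {U : Type u} (N : Net U) where
  S : Set ZFSet.{u}
  T : Set ZFSet.{u}
  R : ZFSet.{u} → ZFSet.{u} → Prop
  lab : ZFSet.{u} → Option U
  disj : ∀ x ∈ S, x ∉ T
  supp : ∀ {x y}, R x y → (x ∈ S ∧ y ∈ T) ∨ (x ∈ T ∧ y ∈ S)
  lab_S : ∀ x ∈ S, ∃ s ∈ N.S, lab x = some s
  lab_T : ∀ x ∈ T, ∃ t ∈ N.T, lab x = some t
  lab_none : ∀ x, x ∉ S → x ∉ T → lab x = none
  prod_unique : ∀ s ∈ S, ∀ t t', R t s → R t' s → t = t'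
  cons_unique : ∀ s ∈ S, ∀ t t', R s t → R s t' → t = t'
  acyclic : ∀ x, ¬ TransGen R x x
  finite_past : ∀ v ∈ T, {t | t ∈ T ∧ TransGen R t v}.Finite
  card_init : ∀ s, {x | (x ∈ S ∧ ∀ t, ¬ R t x) ∧ lab x = some s}.encard = N.M₀ s
  card_pre : ∀ t ∈ T, ∀ v, lab t = some v → ∀ s, {x | R x t ∧ lab x = some s}.encard = N.F s v
  card_post : ∀ t ∈ T, ∀ v, lab t = some v → ∀ s, {x | R t x ∧ lab x = some s}.encard = N.F v s

namespace Proc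

variable {U : Type u} {N : Net U} (p q r : Proc N)

/-- The set of all places and transitions. -/
def C : Set ZFSet.{u} := p.S ∪ p.T

/-- The places without producers. -/
def I : Set ZFSet.{u} := {x | x ∈ p.S ∧ ∀ t, ¬ p.R t x}

/-- The places without consumers. -/
def E : Set ZFSet.{u} := {x | x ∈ p.S ∧ ∀ t, ¬ p.R x t}

/-- The preplaces of `t`. -/
def pre (t : ZFSet.{u}) : Set ZFSet.{u} := {x | p.R x t}

/-- The postplaces of `t`. -/
def post (t : ZFSet.{u}) : Set ZFSet.{u} := {x | p.R t x}

variable {p q r}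

theorem mem_C_left {x y} (h : p.R x y) : x ∈ p.C := by
  rcases p.supp h with h | h
  · exact Or.inl h.1
  · exact Or.inr h.1

theorem mem_C_right {x y} (h : p.R x y) : y ∈ p.C := by
  rcases p.supp h with h | h
  · exact Or.inr h.2
  · exact Or.inl h.2

theorem mem_S_of_pre {x t} (ht : t ∈ p.T) (h : p.R x t) : x ∈ p.S := by
  rcases p.supp h with h | h
  · exact h.1
  · exact absurd ht (p.disj _ h.2)

theorem mem_S_of_post {x t} (ht : t ∈ p.T) (h : p.R t x) : x ∈ p.S := by
  rcases p.supp h with h | h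
  · exact absurd ht (p.disj _ h.1)
  · exact h.2

theorem mem_T_of_prod {x t} (hx : x ∈ p.S) (h : p.R t x) : t ∈ p.T := by
  rcases p.supp h with h | h
  · exact absurd h.2 (p.disj _ hx)
  · exact h.1

theorem mem_T_of_cons {x t} (hx : x ∈ p.S) (h : p.R x t) : t ∈ p.T := by
  rcases p.supp h with h | h
  · exact h.2
  · exact absurd h.1 (p.disj _ hx)

theorem TransGen_mem_left {x y} (h : TransGen p.R x y) : x ∈ p.C := by
  induction h with
  | single h => exact mem_C_left h
  | tail _ _ ih => exact ih

theorem mem_C_iff {x} : x ∈ p.C ↔ p.lab x ≠ none := by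
  constructor
  · rintro (h | h)
    · obtain ⟨s, -, h⟩ := p.lab_S _ h
      simp [h]
    · obtain ⟨s, -, h⟩ := p.lab_T _ h
      simp [h]
  · intro h
    by_contra h'
    exact h (p.lab_none _ (fun h => h' (Or.inl h)) (fun h => h' (Or.inr h)))

/-- A set with finite fibres over a finite set of labels is finite. -/
theorem finite_of_fibers {A : Set ZFSet.{u}} (f : U → ℕ) (hf : {s | 0 < f s}.Finite)
    {lab : ZFSet.{u} → Option U} (hlab : ∀ x ∈ A, ∃ s, lab x = some s)
    (hA : ∀ s, {x | x ∈ A ∧ lab x = some s}.encard = f s) : A.Finite := by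
  refine (hf.biUnion (t := fun s => {x | x ∈ A ∧ lab x = some s})
    fun s _ => Set.finite_of_encard_eq_coe (hA s)).subset ?_
  intro x hx
  obtain ⟨s, hs⟩ := hlab x hx
  refine Set.mem_biUnion (x := s) ?_ ⟨hx, hs⟩
  by_contra h
  have h0 : f s = 0 := by simpa using h
  have h1 := hA s
  rw [h0, Nat.cast_zero, Set.encard_eq_zero] at h1
  exact (Set.ext_iff.1 h1 x).1 ⟨hx, hs⟩

theorem pre_finite {t} (ht : t ∈ p.T) : (p.pre t).Finite := by
  obtain ⟨v, hv, h⟩ := p.lab_T t ht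
  refine finite_of_fibers _ (N.pre_finite v hv) (lab := p.lab) ?_ (p.card_pre t ht v h)
  intro x hx
  obtain ⟨s, -, hs⟩ := p.lab_S x (mem_S_of_pre ht hx)
  exact ⟨s, hs⟩

theorem post_finite {t} (ht : t ∈ p.T) : (p.post t).Finite := by
  obtain ⟨v, hv, h⟩ := p.lab_T t ht
  refine finite_of_fibers _ (N.post_finite v hv) (lab := p.lab) ?_ (p.card_post t ht v h)
  intro x hx
  obtain ⟨s, -, hs⟩ := p.lab_S x (mem_S_of_post ht hx)
  exact ⟨s, hs⟩

theorem pre_nonempty {t} (ht : t ∈ p.T) : (p.pre t).Nonempty := by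
  obtain ⟨v, hv, h⟩ := p.lab_T t ht
  obtain ⟨s, hs⟩ := N.pre_nonempty v hv
  have h1 := p.card_pre t ht v h s
  have h2 : {x | p.R x t ∧ p.lab x = some s}.Nonempty := by
    rw [Set.nonempty_iff_ne_empty, Ne, ← Set.encard_eq_zero, h1]
    have : N.F s v ≠ 0 := Nat.pos_iff_ne_zero.1 hs
    exact_mod_cast this
  obtain ⟨x, hx⟩ := h2
  exact ⟨x, hx.1⟩

/-! ### Conversion to and from GR-processes -/

theorem ext_gr {P Q : GRProcess N} (hS : P.net.S = Q.net.S) (hT : P.net.T = Q.net.T)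
    (hF : P.net.F = Q.net.F) (hM : P.net.M₀ = Q.net.M₀)
    (hπ : ∀ x h h', P.π ⟨x, h⟩ = Q.π ⟨x, h'⟩) : P = Q := by
  obtain ⟨⟨S, T, F, M, _, _, _, _, _, _⟩, _, _, _, _, _, _, _, π, _, _, _, _, _⟩ := P
  obtain ⟨⟨S', T', F', M', _, _, _, _, _, _⟩, _, _, _, _, _, _, _, π', _, _, _, _, _⟩ := Q
  dsimp only at hS hT hF hM hπ
  subst hS hT hF hM
  obtain rfl : π = π' := funext fun x => hπ x.1 x.2 x.2
  rfl

/-! ### Smallness of the sets of places and transitions, and fresh elements. -/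

theorem small_of_fibers {A : Set ZFSet.{u}} {lab : ZFSet.{u} → Option U}
    (hlab : ∀ x ∈ A, ∃ s, lab x = some s)
    (hA : ∀ s, {x | x ∈ A ∧ lab x = some s}.Finite) : Small.{u} A := by
  have h : A = ⋃ s : U, {x | x ∈ A ∧ lab x = some s} := by
    ext x
    simp only [Set.mem_iUnion, Set.mem_ofPred_eq]
    exact ⟨fun hx => (hlab x hx).imp fun s hs => ⟨hx, hs⟩, fun ⟨s, h⟩ => h.1⟩
  rw [h]
  have : ∀ s : U, Small.{u} {x | x ∈ A ∧ lab x = some s} := fun s =>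
    have := (hA s).to_subtype
    Countable.toSmall _
  exact small_iUnion _

/-- The places and transitions of `p` generated after `n` rounds. -/
def stage (p : Proc N) : ℕ → Set ZFSet.{u}
  | 0 => p.I
  | n + 1 => stage p n ∪ {t | t ∈ p.T ∧ p.pre t ⊆ stage p n}
      ∪ ⋃ t : {t | t ∈ p.T ∧ p.pre t ⊆ stage p n}, p.post t

/-- A transition has a preplace, and a place has at most one consumer; so the transitions with all
preplaces in a stage inject into that stage, and each contributes finitely many postplaces. -/
theorem small_stage (n : ℕ) : Small.{u} (p.stage n) := by
  induction n with
  | zero =>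
    refine small_of_fibers (lab := p.lab) ?_ fun s => Set.finite_of_encard_eq_coe (p.card_init s)
    intro x hx
    obtain ⟨s, -, hs⟩ := p.lab_S x hx.1
    exact ⟨s, hs⟩
  | succ n ih =>
    have h1 : Small.{u} {t | t ∈ p.T ∧ p.pre t ⊆ p.stage n} := by
      choose! f hf using fun t (ht : t ∈ p.T) => pre_nonempty ht
      refine small_of_injective (β := p.stage n)
        (f := fun t : {t | t ∈ p.T ∧ p.pre t ⊆ p.stage n} => ⟨f t, t.2.2 (hf _ t.2.1)⟩) ?_
      rintro ⟨t, ht⟩ ⟨t', ht'⟩ h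
      have h2 : f t = f t' := congrArg Subtype.val h
      have h3 : p.R (f t) t := hf t ht.1
      have h4 : p.R (f t) t' := h2 ▸ hf t' ht'.1
      exact Subtype.ext (p.cons_unique _ (mem_S_of_pre ht.1 h3) _ _ h3 h4)
    have h2 : ∀ t : {t | t ∈ p.T ∧ p.pre t ⊆ p.stage n}, Small.{u} (p.post t) := fun t =>
      have := (post_finite t.2.1).to_subtype
      Countable.toSmall _
    have := small_iUnion.{u} fun t : {t | t ∈ p.T ∧ p.pre t ⊆ p.stage n} => p.post t
    have := small_union.{u} (p.stage n) {t | t ∈ p.T ∧ p.pre t ⊆ p.stage n}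
    exact small_union.{u} _ _

theorem stage_mono {m n : ℕ} (h : m ≤ n) : p.stage m ⊆ p.stage n := by
  induction h with
  | refl => exact subset_rfl
  | step _ ih => exact ih.trans fun x hx => Or.inl (Or.inl hx)

/-- Causal predecessors form a well-founded relation on transitions. -/
theorem trans_induction {P : ZFSet.{u} → Prop}
    (h : ∀ t ∈ p.T, (∀ v ∈ p.T, TransGen p.R v t → P v) → P t) : ∀ t ∈ p.T, P t := by
  suffices H : ∀ n : ℕ, ∀ t ∈ p.T, {v | v ∈ p.T ∧ TransGen p.R v t}.ncard ≤ n → P t from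
    fun t ht => H _ t ht le_rfl
  intro n
  induction n with
  | zero =>
    intro t ht hn
    have h0 := (Set.ncard_eq_zero (p.finite_past t ht)).1 (Nat.le_zero.1 hn)
    exact h t ht fun v hv hvt => absurd (show v ∈ {v | v ∈ p.T ∧ TransGen p.R v t} from ⟨hv, hvt⟩)
      (by rw [h0]; exact Set.notMem_empty _)
  | succ n ih =>
    intro t ht hn
    refine h t ht fun v hv hvt => ih v hv ?_
    have : {w | w ∈ p.T ∧ TransGen p.R w v}.ncard < {w | w ∈ p.T ∧ TransGen p.R w t}.ncard := by
      refine Set.ncard_lt_ncard ?_ (p.finite_past t ht)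
      refine ⟨fun w hw => ⟨hw.1, hw.2.trans hvt⟩, fun hsub => ?_⟩
      exact p.acyclic v (hsub ⟨hv, hvt⟩ : v ∈ {w | w ∈ p.T ∧ TransGen p.R w v}).2
    omega

/-- By induction along causality: each of the finitely many preplaces appears at some stage, and the
transition appears one round after the latest of them. -/
theorem exists_stage : ∀ t ∈ p.T, ∃ n, t ∈ p.stage n := by
  refine trans_induction fun t ht ih => ?_
  have h1 : ∀ x ∈ p.pre t, ∃ n, x ∈ p.stage n := by
    intro x hx
    by_cases hI : ∃ v, p.R v x
    · obtain ⟨v, hv⟩ := hI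
      have hvT := mem_T_of_prod (mem_S_of_pre ht hx) hv
      obtain ⟨n, hn⟩ := ih v hvT ((TransGen.single hv).tail hx)
      cases n with
      | zero => exact absurd hvT (p.disj _ hn.1)
      | succ n =>
        refine ⟨n + 1, ?_⟩
        -- A transition enters a stage together with its postplaces, so no further round is needed
        -- for `x`.
        suffices H : ∀ n, v ∈ p.stage n → x ∈ p.stage n from H _ hn
        intro n
        induction n with
        | zero => exact fun hn => absurd hvT (p.disj _ hn.1)
        | succ n ihn =>
          rintro ((h | h) | h)
          · exact Or.inl (Or.inl (ihn h))
          · exact Or.inr (Set.mem_iUnion.2 ⟨⟨v, h⟩, hv⟩)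
          · obtain ⟨w, hw⟩ := Set.mem_iUnion.1 h
            exact absurd hvT (p.disj _ (mem_S_of_post w.2.1 hw))
    · exact ⟨0, mem_S_of_pre ht hx, fun v hv => hI ⟨v, hv⟩⟩
  choose! n hn using h1
  obtain ⟨m, hm⟩ := ((pre_finite ht).image n).bddAbove
  refine ⟨m + 1, Or.inl (Or.inr ⟨ht, fun x hx => ?_⟩)⟩
  exact stage_mono (hm (Set.mem_image_of_mem n hx)) (hn x hx)

instance small_T : Small.{u} p.T := by
  have : ∀ n, Small.{u} (p.stage n) := small_stage
  have h2 : p.T ⊆ ⋃ n, p.stage n := fun t ht => Set.mem_iUnion.2 (exists_stage t ht)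
  exact small_subset h2

instance small_S : Small.{u} p.S := by
  have h0 : Small.{u} p.I := small_stage (p := p) 0
  have h1 : ∀ t : p.T, Small.{u} (p.post t) := fun t =>
    have := (post_finite t.2).to_subtype
    Countable.toSmall _
  have h2 := small_iUnion.{u} fun t : p.T => p.post t
  have h3 := small_union.{u} p.I (⋃ t : p.T, p.post t)
  refine @small_subset _ (p.I ∪ ⋃ t : p.T, p.post t) _ (fun x hx => ?_) h3
  by_cases h : ∃ t, p.R t x
  · obtain ⟨t, ht⟩ := h
    exact Or.inr (Set.mem_iUnion.2 ⟨⟨t, mem_T_of_prod hx ht⟩, ht⟩)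
  · exact Or.inl ⟨hx, fun t ht => h ⟨t, ht⟩⟩

instance small_C : Small.{u} p.C := small_union.{u} p.S p.T

end Proc

/-- Every `u`-small type embeds into the complement of any `u`-small set of sets. -/
theorem exists_fresh (α : Type u) (D : Set ZFSet.{u}) [Small.{u} D] :
    ∃ e : α → ZFSet.{u}, Function.Injective e ∧ ∀ a, e a ∉ D := by
  rcases Function.Embedding.total α ↥Dᶜ with he | he <;> obtain ⟨e⟩ := he
  · exact ⟨fun a => e a, Subtype.val_injective.comp e.injective, fun a => (e a).2⟩
  · exfalso
    have h1 : Small.{u} ↥Dᶜ := small_of_injective e.injective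
    have h2 := small_union.{u} D Dᶜ
    rw [Set.union_compl_self] at h2
    -- If the class of all sets were small, it would be a set that is a member of itself.
    let f : ↥(Set.univ : Set ZFSet.{u}) → ZFSet.{u} := Subtype.val
    have h3 : ZFSet.range f ∈ ZFSet.range f := ZFSet.mem_range.2 ⟨⟨_, trivial⟩, rfl⟩
    exact ZFSet.mem_irrefl _ h3

/-! ### Prefixes and restriction to causally closed sets of transitions. -/

namespace Proc

variable {U : Type u} {N : Net U} {p q r : Proc N}

theorem finite_past' (x : ZFSet.{u}) : {t | t ∈ p.T ∧ TransGen p.R t x}.Finite := by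
  by_cases hx : x ∈ p.T
  · exact p.finite_past x hx
  by_cases h : ∃ w, p.R w x
  · obtain ⟨w, hw⟩ := h
    have hxS : x ∈ p.S := (mem_C_right hw).resolve_right hx
    refine ((p.finite_past w (mem_T_of_prod hxS hw)).insert w).subset ?_
    rintro t ⟨ht, htx⟩
    rcases TransGen.tail'_iff.1 htx with ⟨w', h1, h2⟩
    obtain rfl := p.prod_unique x hxS _ _ hw h2
    rcases reflTransGen_iff_eq_or_transGen.1 h1 with h3 | h3
    · exact Or.inl h3.symm
    · exact Or.inr ⟨ht, h3⟩
  · refine Set.finite_empty.subset ?_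
    rintro t ⟨-, htx⟩
    rcases TransGen.tail'_iff.1 htx with ⟨w', -, h2⟩
    exact h ⟨w', h2⟩

/-- `p` is a prefix of `q`. -/
structure Le (p q : Proc N) : Prop where
  S_sub : p.S ⊆ q.S
  T_sub : p.T ⊆ q.T
  lab_eq : ∀ x ∈ p.C, q.lab x = p.lab x
  R_sub : ∀ {x y}, p.R x y → q.R x y
  back : ∀ {x y}, q.R x y → y ∈ p.C ∨ x ∈ p.T → p.R x y

namespace Le

theorem refl (p : Proc N) : Le p p :=
  ⟨subset_rfl, subset_rfl, fun _ _ => rfl, id, fun h _ => h⟩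

theorem C_sub (h : Le p q) : p.C ⊆ q.C := Set.union_subset_union h.S_sub h.T_sub

theorem trans (h : Le p q) (h' : Le q r) : Le p r where
  S_sub := h.S_sub.trans h'.S_sub
  T_sub := h.T_sub.trans h'.T_sub
  lab_eq x hx := (h'.lab_eq x (h.C_sub hx)).trans (h.lab_eq x hx)
  R_sub hR := h'.R_sub (h.R_sub hR)
  back hR hxy := h.back (h'.back hR (hxy.imp (fun hy => h.C_sub hy) fun hx => h.T_sub hx)) hxy

theorem I_sub (h : Le p q) : p.I ⊆ q.I := fun _ hx =>
  ⟨h.S_sub hx.1, fun t ht => hx.2 t (h.back ht (Or.inl (Or.inl hx.1)))⟩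

/-- Both processes have exactly `N.M₀ s` initial places labelled `s`, a finite number, so inclusion
forces equality. This is why `Le` need not mention initial markings. -/
theorem I_eq (h : Le p q) : p.I = q.I := by
  refine h.I_sub.antisymm fun x hx => ?_
  obtain ⟨s, -, hs⟩ := q.lab_S x hx.1
  have hfin : {x | x ∈ p.I ∧ p.lab x = some s}.Finite := Set.finite_of_encard_eq_coe (p.card_init s)
  have heq := hfin.eq_of_subset_of_encard_le (t := {x | x ∈ q.I ∧ q.lab x = some s})
    (fun y hy => ⟨h.I_sub hy.1, (h.lab_eq y (Or.inl hy.1.1)).trans hy.2⟩)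
    ((q.card_init s).trans (p.card_init s).symm).le
  exact ((Set.ext_iff.1 heq x).2 ⟨hx, hs⟩).1

/-- A prefix is closed under going backwards along arcs. -/
theorem transGen (h : Le p q) {a b} (hab : TransGen q.R a b) (hb : b ∈ p.C) :
    TransGen p.R a b := by
  induction hab using TransGen.head_induction_on with
  | single hR => exact TransGen.single (h.back hR (Or.inl hb))
  | head hR _ ih => exact ih.head (h.back hR (Or.inl (TransGen_mem_left ih)))

/-- A place is initial or a postplace of a transition, so a prefix is determined by its transitions.
-/
theorem eq_of_T_sub (h : Le p q) (hT : q.T ⊆ p.T) : p = q := by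
  have hT' : p.T = q.T := h.T_sub.antisymm hT
  have hR : p.R = q.R := by
    ext x y
    refine ⟨h.R_sub, fun hR => h.back hR ?_⟩
    rcases q.supp hR with h' | h'
    · exact Or.inl (Or.inr (hT h'.2))
    · exact Or.inr (hT h'.1)
  have hS : p.S = q.S := by
    refine h.S_sub.antisymm fun x hx => ?_
    by_cases hp : ∃ t, q.R t x
    · obtain ⟨t, ht⟩ := hp
      exact mem_S_of_post (hT (mem_T_of_prod hx ht)) (hR ▸ ht)
    · have : x ∈ q.I := ⟨hx, fun t ht => hp ⟨t, ht⟩⟩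
      rw [← h.I_eq] at this
      exact this.1
  refine Proc.ext hS hT' hR (funext fun x => ?_)
  by_cases hx : x ∈ p.C
  · exact (h.lab_eq x hx).symm
  · have hx' : x ∉ q.C := fun hx' => hx (by rwa [C, hS, hT'])
    rw [mem_C_iff, not_not] at hx hx'
    rw [hx, hx']

theorem antisymm (h : Le p q) (h' : Le q p) : p = q := h.eq_of_T_sub h'.T_sub

end Le

open Classical in
/-- The prefix of `q` with transitions `D`. -/
noncomputable def restrict (q : Proc N) (D : Set ZFSet.{u}) (hD : D ⊆ q.T)
    (hc : ∀ v ∈ D, ∀ t ∈ q.T, TransGen q.R t v → t ∈ D) : Proc N where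
  S := {s | s ∈ q.S ∧ ∀ t, q.R t s → t ∈ D}
  T := D
  R x y := q.R x y ∧ (x ∈ D ∨ y ∈ D)
  lab x := if (x ∈ q.S ∧ ∀ t, q.R t x → t ∈ D) ∨ x ∈ D then q.lab x else none
  disj x hx hx' := q.disj x hx.1 (hD hx')
  supp := by
    rintro x y ⟨hR, hxy⟩
    rcases q.supp hR with h | h
    · have hy : y ∈ D := hxy.resolve_left fun hx => q.disj x h.1 (hD hx)
      exact Or.inl ⟨⟨h.1, fun t ht => hc y hy t (mem_T_of_prod h.1 ht)
        ((TransGen.single ht).tail hR)⟩, hy⟩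
    · have hx : x ∈ D := hxy.resolve_right fun hy => q.disj y h.2 (hD hy)
      exact Or.inr ⟨hx, h.2, fun t ht => q.prod_unique y h.2 _ _ hR ht ▸ hx⟩
  lab_S x hx := by
    have h : x ∈ q.S ∧ ∀ t, q.R t x → t ∈ D := hx
    rw [if_pos (Or.inl h)]
    exact q.lab_S x hx.1
  lab_T x hx := by
    rw [if_pos (Or.inr hx)]
    exact q.lab_T x (hD hx)
  lab_none x hx hx' := if_neg fun h => h.elim hx hx'
  prod_unique s hs t t' h h' := q.prod_unique s hs.1 t t' h.1 h'.1
  cons_unique s hs t t' h h' := q.cons_unique s hs.1 t t' h.1 h'.1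
  acyclic x h := q.acyclic x (h.lift id fun _ _ h => h.1)
  finite_past v hv := (q.finite_past v (hD hv)).subset fun t ht =>
    ⟨hD ht.1, ht.2.lift id fun _ _ h => h.1⟩
  card_init s := by
    rw [← q.card_init s]
    congr 1
    ext x
    constructor
    · rintro ⟨⟨hx, hx'⟩, hl⟩
      have h : x ∈ q.S ∧ ∀ t, q.R t x → t ∈ D := hx
      rw [if_pos (Or.inl h)] at hl
      exact ⟨⟨hx.1, fun t ht => hx' t ⟨ht, Or.inl (hx.2 t ht)⟩⟩, hl⟩
    · rintro ⟨⟨hx, hx'⟩, hl⟩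
      have h : x ∈ q.S ∧ ∀ t, q.R t x → t ∈ D := ⟨hx, fun t ht => absurd ht (hx' t)⟩
      refine ⟨⟨h, fun t ht => hx' t ht.1⟩, ?_⟩
      rw [if_pos (Or.inl h)]
      exact hl
  card_pre t ht v hv s := by
    rw [if_pos (Or.inr ht)] at hv
    rw [← q.card_pre t (hD ht) v hv s]
    congr 1
    ext x
    have key : q.R x t → x ∈ q.S ∧ ∀ t, q.R t x → t ∈ D := fun hR =>
      ⟨mem_S_of_pre (hD ht) hR, fun w hw => hc t ht w (mem_T_of_prod (mem_S_of_pre (hD ht) hR) hw)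
        ((TransGen.single hw).tail hR)⟩
    constructor
    · rintro ⟨hR, hl⟩
      rw [if_pos (Or.inl (key hR.1))] at hl
      exact ⟨hR.1, hl⟩
    · rintro ⟨hR, hl⟩
      refine ⟨⟨hR, Or.inr ht⟩, ?_⟩
      rw [if_pos (Or.inl (key hR))]
      exact hl
  card_post t ht v hv s := by
    rw [if_pos (Or.inr ht)] at hv
    rw [← q.card_post t (hD ht) v hv s]
    congr 1
    ext x
    have key : q.R t x → x ∈ q.S ∧ ∀ t, q.R t x → t ∈ D := fun hR =>
      ⟨mem_S_of_post (hD ht) hR, fun w hw =>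
        q.prod_unique x (mem_S_of_post (hD ht) hR) _ _ hR hw ▸ ht⟩
    constructor
    · rintro ⟨hR, hl⟩
      rw [if_pos (Or.inl (key hR.1))] at hl
      exact ⟨hR.1, hl⟩
    · rintro ⟨hR, hl⟩
      refine ⟨⟨hR, Or.inl ht⟩, ?_⟩
      rw [if_pos (Or.inl (key hR))]
      exact hl

theorem restrict_le (q : Proc N) (D : Set ZFSet.{u}) (hD : D ⊆ q.T)
    (hc : ∀ v ∈ D, ∀ t ∈ q.T, TransGen q.R t v → t ∈ D) : Le (q.restrict D hD hc) q where
  S_sub _ hx := hx.1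
  T_sub := hD
  lab_eq x hx := (if_pos hx).symm
  R_sub h := h.1
  back := by
    rintro x y hR (hy | hx)
    · refine ⟨hR, ?_⟩
      rcases hy with hy | hy
      · exact Or.inl (hy.2 x hR)
      · exact Or.inr hy
    · exact ⟨hR, Or.inl hx⟩

theorem le_restrict (h : Le p q) {D : Set ZFSet.{u}} (hD : D ⊆ q.T)
    (hc : ∀ v ∈ D, ∀ t ∈ q.T, TransGen q.R t v → t ∈ D) (hp : p.T ⊆ D) :
    Le p (q.restrict D hD hc) where
  S_sub x hx := ⟨h.S_sub hx, fun t ht =>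
    hp (mem_T_of_prod hx (h.back ht (Or.inl (Or.inl hx))))⟩
  T_sub := hp
  lab_eq x hx := by
    refine (if_pos ?_).trans (h.lab_eq x hx)
    rcases hx with hx | hx
    · exact Or.inl ⟨h.S_sub hx, fun t ht => hp (mem_T_of_prod hx (h.back ht (Or.inl (Or.inl hx))))⟩
    · exact Or.inr (hp hx)
  R_sub := by
    intro x y hR
    refine ⟨h.R_sub hR, ?_⟩
    rcases p.supp hR with h' | h'
    · exact Or.inr (hp h'.2)
    · exact Or.inl (hp h'.1)
  back hR hxy := h.back hR.1 hxy

/-! ### Swapping -/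

open Classical in
-- A path of the swapped process that leaves `a` continues as a path of `p` from `b`, and
-- conversely. It crosses over at most once, since a second crossing would give a path between `a`
-- and `b` or a cycle.
theorem transGen_swap {a b x y} (hab : ¬ TransGen p.R a b) (hba : ¬ TransGen p.R b a)
    (h : TransGen (fun x y => p.R (Equiv.swap a b x) y) x y) :
    TransGen p.R x y ∨ (ReflTransGen p.R x a ∧ TransGen p.R b y) ∨
      (ReflTransGen p.R x b ∧ TransGen p.R a y) := by
  induction h with
  | @single y h =>
    rcases eq_or_ne x a with rfl | hxa
    · rw [Equiv.swap_apply_left] at h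
      exact Or.inr (Or.inl ⟨.refl, .single h⟩)
    rcases eq_or_ne x b with rfl | hxb
    · rw [Equiv.swap_apply_right] at h
      exact Or.inr (Or.inr ⟨.refl, .single h⟩)
    rw [Equiv.swap_apply_of_ne_of_ne hxa hxb] at h
    exact Or.inl (.single h)
  | @tail y z _ h ih =>
    rcases eq_or_ne y a with rfl | hya
    · rw [Equiv.swap_apply_left] at h
      rcases ih with ih | ih | ih
      · exact Or.inr (Or.inl ⟨ih.to_reflTransGen, .single h⟩)
      · exact absurd ih.2 hba
      · exact absurd ih.2 (p.acyclic _)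
    rcases eq_or_ne y b with rfl | hyb
    · rw [Equiv.swap_apply_right] at h
      rcases ih with ih | ih | ih
      · exact Or.inr (Or.inr ⟨ih.to_reflTransGen, .single h⟩)
      · exact absurd ih.2 (p.acyclic _)
      · exact absurd ih.2 hab
    rw [Equiv.swap_apply_of_ne_of_ne hya hyb] at h
    exact ih.imp (fun ih => ih.tail h)
      (Or.imp (fun ih => ⟨ih.1, ih.2.tail h⟩) fun ih => ⟨ih.1, ih.2.tail h⟩)

open Classical in
theorem swap_mem_S {a b : ZFSet.{u}} (ha : a ∈ p.S) (hb : b ∈ p.S) {x} :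
    Equiv.swap a b x ∈ p.S ↔ x ∈ p.S := by
  rcases eq_or_ne x a with rfl | hxa
  · simp [ha, hb]
  rcases eq_or_ne x b with rfl | hxb
  · simp [ha, hb]
  rw [Equiv.swap_apply_of_ne_of_ne hxa hxb]

open Classical in
theorem swap_of_mem_T {a b : ZFSet.{u}} (ha : a ∈ p.S) (hb : b ∈ p.S) {x} (hx : x ∈ p.T) :
    Equiv.swap a b x = x :=
  Equiv.swap_apply_of_ne_of_ne (fun h => p.disj a ha (h ▸ hx)) fun h => p.disj b hb (h ▸ hx)

open Classical in
theorem lab_swap {a b : ZFSet.{u}} (hl : p.lab a = p.lab b) (x) :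
    p.lab (Equiv.swap a b x) = p.lab x := by
  rcases eq_or_ne x a with rfl | hxa
  · simp [hl]
  rcases eq_or_ne x b with rfl | hxb
  · simp [hl]
  rw [Equiv.swap_apply_of_ne_of_ne hxa hxb]

/-- `a` and `b` are causally unrelated places with the same label. -/
structure Unrel (p : Proc N) (a b : ZFSet.{u}) : Prop where
  ha : a ∈ p.S
  hb : b ∈ p.S
  hab : ¬ TransGen p.R a b
  hba : ¬ TransGen p.R b a
  hl : p.lab a = p.lab b

open Classical in
theorem swap_supp {a b : ZFSet.{u}} (ha : a ∈ p.S) (hb : b ∈ p.S) {x y}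
    (h : p.R (Equiv.swap a b x) y) : (x ∈ p.S ∧ y ∈ p.T) ∨ (x ∈ p.T ∧ y ∈ p.S ∧ p.R x y) := by
  rcases p.supp h with h' | h'
  · exact Or.inl ⟨(swap_mem_S ha hb).1 h'.1, h'.2⟩
  · have h2 := swap_of_mem_T ha hb h'.1
    rw [Equiv.swap_apply_self] at h2
    rw [← h2] at h h'
    exact Or.inr ⟨h'.1, h'.2, h⟩

open Classical in
/-- Exchange the outgoing arcs of `a` and `b`. -/
noncomputable def swap (p : Proc N) {a b : ZFSet.{u}} (h : p.Unrel a b) : Proc N where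
  S := p.S
  T := p.T
  R x y := p.R (Equiv.swap a b x) y
  lab := p.lab
  disj := p.disj
  supp hR := (swap_supp h.ha h.hb hR).imp_right fun h => ⟨h.1, h.2.1⟩
  lab_S := p.lab_S
  lab_T := p.lab_T
  lab_none := p.lab_none
  prod_unique s hs t t' ht ht' := by
    have key : ∀ {t}, p.R (Equiv.swap a b t) s → p.R t s := fun ht =>
      ((swap_supp h.ha h.hb ht).resolve_left fun h => p.disj s hs h.2).2.2
    exact p.prod_unique s hs t t' (key ht) (key ht')
  cons_unique s hs t t' := p.cons_unique _ ((swap_mem_S h.ha h.hb).2 hs) t t'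
  acyclic x hx := by
    rcases transGen_swap h.hab h.hba hx with h' | h' | h'
    · exact p.acyclic x h'
    · exact h.hba (h'.2.trans_left h'.1)
    · exact h.hab (h'.2.trans_left h'.1)
  finite_past v hv := by
    -- A new causal predecessor of `v` arises only by crossing over, so it lies in the old past of
    -- `a` or of `b`.
    refine ((p.finite_past v hv).union ((finite_past' (p := p) a).union
      (finite_past' (p := p) b))).subset ?_
    rintro t ⟨ht, htv⟩
    have key : ∀ {c}, c ∈ p.S → ReflTransGen p.R t c → TransGen p.R t c := fun hc htc =>
      (reflTransGen_iff_eq_or_transGen.1 htc).resolve_left fun he => p.disj _ hc (he ▸ ht)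
    rcases transGen_swap h.hab h.hba htv with h' | h' | h'
    · exact Or.inl ⟨ht, h'⟩
    · exact Or.inr (Or.inl ⟨ht, key h.ha h'.1⟩)
    · exact Or.inr (Or.inr ⟨ht, key h.hb h'.1⟩)
  card_init s := by
    rw [← p.card_init s]
    congr 1
    ext x
    refine and_congr_left fun _ => and_congr_right fun hx => forall_congr' fun t => not_congr ?_
    constructor
    · intro ht
      exact ((swap_supp h.ha h.hb ht).resolve_left fun h => p.disj x hx h.2).2.2
    · intro ht
      rwa [swap_of_mem_T h.ha h.hb (mem_T_of_prod hx ht)]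
  card_pre t ht v hv s := by
    rw [← p.card_pre t ht v hv s, ← (Equiv.swap a b).injective.encard_image]
    congr 1
    ext x
    constructor
    · rintro ⟨y, ⟨hy, hl⟩, rfl⟩
      exact ⟨hy, (lab_swap h.hl y).trans hl⟩
    · rintro ⟨hx, hl⟩
      refine ⟨Equiv.swap a b x, ⟨?_, (lab_swap h.hl x).trans hl⟩, Equiv.swap_apply_self ..⟩
      rwa [Equiv.swap_apply_self]
  card_post t ht v hv s := by
    rw [← p.card_post t ht v hv s]
    simp only [swap_of_mem_T h.ha h.hb ht]

end Proc

/-! ### One-transition extensions and the existence of maximal processes. -/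

namespace Proc

variable {U : Type u} {N : Net U} {p q r : Proc N}

/-- `q` extends `p` by one transition `x` with label `v` and set of preplaces `A`. -/
structure Ext (p q : Proc N) (x : ZFSet.{u}) (v : U) (A : Set ZFSet.{u}) : Prop where
  le : Le p q
  notMem : x ∉ p.T
  T_eq : q.T = insert x p.T
  lab_eq : q.lab x = some v
  pre_eq : q.pre x = A

/-- Counts freshly created places: `f s` of them for each label `s`, indexed by `Fin (f s)`. Serves
for initial places and for postplaces of a new transition. -/
theorem encard_fiber {α : Type u} {f : U → ℕ} {e : α → ZFSet.{u}} (he : Function.Injective e)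
    (g : ∀ s, Fin (f s) → α) (hg : ∀ s, Function.Injective (g s)) {A : Set ZFSet.{u}}
    {lab : ZFSet.{u} → Option U}
    (hA : ∀ x, x ∈ A ↔ ∃ s i, e (g s i) = x) (hlab : ∀ s i, lab (e (g s i)) = some s) (s : U) :
    {x | x ∈ A ∧ lab x = some s}.encard = f s := by
  have h : {x | x ∈ A ∧ lab x = some s} = Set.range fun i => e (g s i) := by
    ext x
    constructor
    · rintro ⟨hx, hl⟩
      obtain ⟨s', i, rfl⟩ := (hA x).1 hx
      rw [hlab, Option.some_inj] at hl
      subst hl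
      exact ⟨i, rfl⟩
    · rintro ⟨i, rfl⟩
      exact ⟨(hA _).2 ⟨s, i, rfl⟩, hlab s i⟩
  have hi : Function.Injective fun i => e (g s i) := he.comp (hg s)
  rw [h, ← Set.image_univ, hi.encard_image, Set.encard_univ]
  simp

theorem flow_zero_of_notMem {v s : U} (hv : v ∈ N.T) (hs : N.F v s ≠ 0) : s ∈ N.S := by
  rcases N.F_support _ _ hs with h | h
  · exact absurd hv (Set.disjoint_left.1 N.disjoint h.1)
  · exact h.2

/-- A backward closed set contains all causal predecessors. -/
theorem transGen_of_closed {R R' : ZFSet.{u} → ZFSet.{u} → Prop} {C : Set ZFSet.{u}}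
    (h : ∀ a b, b ∈ C → R' a b → R a b ∧ a ∈ C) {a b} (hab : TransGen R' a b) (hb : b ∈ C) :
    TransGen R a b ∧ a ∈ C := by
  induction hab using TransGen.head_induction_on with
  | single hR => exact ⟨.single (h _ _ hb hR).1, (h _ _ hb hR).2⟩
  | head hR _ ih => exact ⟨ih.1.head (h _ _ ih.2 hR).1, (h _ _ ih.2 hR).2⟩

/-- A transition can be appended to a process if its preplaces are available. -/
theorem exists_ext (p : Proc N) {v : U} (hv : v ∈ N.T) {A : Set ZFSet.{u}} (hA : A ⊆ p.E)
    (hc : ∀ s, {x | x ∈ A ∧ p.lab x = some s}.encard = N.F s v) : ∃ q x, Ext p q x v A := by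
  -- The index `none` names the new transition, and `some ⟨s, i⟩` its `i`-th postplace labelled `s`.
  obtain ⟨e, he, hfresh⟩ := exists_fresh (Option (Σ s : U, Fin (N.F v s))) p.C
  let g : Option (Σ s : U, Fin (N.F v s)) → U := fun a => a.elim v Sigma.fst
  let lab : ZFSet.{u} → Option U := Function.extend e (fun a => some (g a)) p.lab
  have lab_e : ∀ a, lab (e a) = some (g a) := fun a => he.extend_apply _ _ a
  have lab_p : ∀ x, (∀ a, e a ≠ x) → lab x = p.lab x := fun x hx =>
    Function.extend_apply' _ _ _ fun ⟨a, ha⟩ => hx a ha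
  have lab_C : ∀ x ∈ p.C, lab x = p.lab x := fun x hx =>
    lab_p x fun a ha => hfresh a (ha ▸ hx)
  obtain ⟨x₀, hx₀⟩ : ∃ x₀, x₀ = e none := ⟨_, rfl⟩
  obtain ⟨B, hB⟩ : ∃ B, B = Set.range fun a => e (some a) := ⟨_, rfl⟩
  have x₀C : x₀ ∉ p.C := hx₀ ▸ hfresh _
  have BC : ∀ x ∈ B, x ∉ p.C := by
    rw [hB]
    rintro _ ⟨a, rfl⟩
    exact hfresh _
  have x₀B : x₀ ∉ B := by
    rw [hx₀, hB]
    rintro ⟨a, ha⟩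
    exact Option.some_ne_none _ (he ha)
  have AS : ∀ x ∈ A, x ∈ p.S := fun x hx => (hA hx).1
  have AC : ∀ x ∈ A, x ∈ p.C := fun x hx => Or.inl (AS x hx)
  have labx₀ : lab x₀ = some v := by rw [hx₀, lab_e]; rfl
  obtain ⟨R, hR⟩ : ∃ R : ZFSet.{u} → ZFSet.{u} → Prop,
      ∀ x y, R x y ↔ p.R x y ∨ (x ∈ A ∧ y = x₀) ∨ (x = x₀ ∧ y ∈ B) :=
    ⟨fun x y => p.R x y ∨ (x ∈ A ∧ y = x₀) ∨ (x = x₀ ∧ y ∈ B), fun _ _ => Iff.rfl⟩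
  have Rright : ∀ a b, b ∈ p.C → R a b → p.R a b ∧ a ∈ p.C := by
    intro a b hb hab
    rcases (hR a b).1 hab with h | ⟨-, h⟩ | ⟨-, h⟩
    · exact ⟨h, mem_C_left h⟩
    · exact absurd (h ▸ hb) x₀C
    · exact absurd hb (BC _ h)
  have RT : ∀ a b, a ∈ p.T → R a b → p.R a b := by
    intro a b ha hab
    rcases (hR a b).1 hab with h | ⟨h, -⟩ | ⟨h, -⟩
    · exact h
    · exact absurd ha (p.disj _ (AS _ h))
    · exact absurd (Or.inr (h ▸ ha)) x₀C
  have Rx₀ : ∀ a, R a x₀ ↔ a ∈ A := by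
    intro a
    rw [hR]
    constructor
    · rintro (h | h | h)
      · exact absurd (mem_C_right h) x₀C
      · exact h.1
      · exact absurd h.2 x₀B
    · exact fun h => Or.inr (Or.inl ⟨h, rfl⟩)
  have x₀R : ∀ b, R x₀ b ↔ b ∈ B := by
    intro b
    rw [hR]
    constructor
    · rintro (h | h | h)
      · exact absurd (mem_C_left h) x₀C
      · exact absurd (AC _ h.1) x₀C
      · exact h.2
    · exact fun h => Or.inr (Or.inr ⟨rfl, h⟩)
  have RB : ∀ a, ∀ b ∈ B, R a b ↔ a = x₀ := by
    intro a b hb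
    rw [hR]
    constructor
    · rintro (h | h | h)
      · exact absurd (mem_C_right h) (BC b hb)
      · exact absurd (h.2 ▸ hb) x₀B
      · exact h.1
    · exact fun h => Or.inr (Or.inr ⟨h, hb⟩)
  have BR : ∀ a ∈ B, ∀ b, ¬ R a b := by
    intro a ha b h
    rcases (hR a b).1 h with h | h | h
    · exact BC a ha (mem_C_left h)
    · exact BC a ha (AC _ h.1)
    · exact x₀B (h.1 ▸ ha)
  -- The past of the new transition lies entirely in `p`; this gives both acyclicity and finiteness
  -- of pasts.
  have past : ∀ {a}, TransGen R a x₀ → a ∈ A ∨ ∃ c ∈ A, TransGen p.R a c := by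
    intro a ha
    obtain ⟨c, h1, h2⟩ := TransGen.tail'_iff.1 ha
    have hc := (Rx₀ c).1 h2
    rcases reflTransGen_iff_eq_or_transGen.1 h1 with rfl | h3
    · exact Or.inl hc
    · exact Or.inr ⟨c, hc, (transGen_of_closed Rright h3 (AC c hc)).1⟩
  have Afin : A.Finite := by
    refine finite_of_fibers _ (N.pre_finite v hv) (lab := p.lab) ?_ hc
    intro x hx
    obtain ⟨s, -, hs⟩ := p.lab_S x (AS x hx)
    exact ⟨s, hs⟩
  refine ⟨{
    S := p.S ∪ B
    T := insert x₀ p.T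
    R := R
    lab := lab
    disj := ?_
    supp := ?_
    lab_S := ?_
    lab_T := ?_
    lab_none := ?_
    prod_unique := ?_
    cons_unique := ?_
    acyclic := ?_
    finite_past := ?_
    card_init := ?_
    card_pre := ?_
    card_post := ?_ }, x₀, ⟨⟨?_, ?_, ?_, ?_, ?_⟩, ?_, rfl, labx₀, ?_⟩⟩
  · rintro x (hx | hx) (hx' | hx')
    · exact x₀C (hx' ▸ Or.inl hx)
    · exact p.disj x hx hx'
    · exact x₀B (hx' ▸ hx)
    · exact BC x hx (Or.inr hx')
  · intro x y h
    rcases (hR x y).1 h with h | h | h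
    · exact (p.supp h).imp (fun h => ⟨Or.inl h.1, Or.inr h.2⟩) fun h => ⟨Or.inr h.1, Or.inl h.2⟩
    · exact Or.inl ⟨Or.inl (AS _ h.1), Or.inl h.2⟩
    · exact Or.inr ⟨Or.inl h.1, Or.inr h.2⟩
  · rintro x (hx | hx)
    · rw [lab_C x (Or.inl hx)]
      exact p.lab_S x hx
    · rw [hB] at hx
      obtain ⟨⟨s, i⟩, rfl⟩ := hx
      exact ⟨s, flow_zero_of_notMem hv (by have := i.2; omega), lab_e _⟩
  · rintro x (hx | hx)
    · exact ⟨v, hv, hx ▸ labx₀⟩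
    · rw [lab_C x (Or.inr hx)]
      exact p.lab_T x hx
  · intro x hx hx'
    rw [lab_p x, p.lab_none x (fun h => hx (Or.inl h)) fun h => hx' (Or.inr h)]
    rintro (_ | a) rfl
    · exact hx' (Or.inl hx₀.symm)
    · exact hx (Or.inr (hB ▸ ⟨a, rfl⟩))
  · rintro s (hs | hs) t t' h h'
    · exact p.prod_unique s hs t t' (Rright _ _ (Or.inl hs) h).1 (Rright _ _ (Or.inl hs) h').1
    · rw [(RB t s hs).1 h, (RB t' s hs).1 h']
  · rintro s (hs | hs) t t' h h'
    · have key : ∀ t, R s t → (p.R s t ∧ s ∉ A) ∨ (s ∈ A ∧ t = x₀) := by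
        intro t ht
        rcases (hR s t).1 ht with h | h | h
        · exact Or.inl ⟨h, fun hA' => (hA hA').2 t h⟩
        · exact Or.inr h
        · exact absurd (h.1 ▸ Or.inl hs) x₀C
      rcases key t h with h1 | h1 <;> rcases key t' h' with h2 | h2
      · exact p.cons_unique s hs t t' h1.1 h2.1
      · exact absurd h2.1 h1.2
      · exact absurd h1.1 h2.2
      · rw [h1.2, h2.2]
    · exact absurd h (BR s hs t)
  · intro x hx
    by_cases hxC : x ∈ p.C
    · exact p.acyclic x (transGen_of_closed Rright hx hxC).1
    obtain ⟨y, h1, -⟩ := TransGen.head'_iff.1 hx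
    rcases (hR x y).1 h1 with h | h | h
    · exact hxC (mem_C_left h)
    · exact hxC (AC _ h.1)
    · rw [h.1] at hx
      rcases past hx with h2 | ⟨c, -, h2⟩
      · exact x₀C (AC _ h2)
      · exact x₀C (TransGen_mem_left h2)
  · intro w hw
    rcases hw with rfl | hw
    · refine (Afin.biUnion (t := fun c => {t | t ∈ p.T ∧ TransGen p.R t c})
        fun c _ => finite_past' c).subset ?_
      rintro t ⟨ht, htw⟩
      rcases past htw with h | ⟨c, hc, h⟩
      · rcases ht with ht | ht
        · exact absurd (AC _ (ht ▸ h)) x₀C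
        · exact absurd ht (p.disj _ (AS _ h))
      · refine Set.mem_biUnion hc ⟨?_, h⟩
        rcases ht with ht | ht
        · exact absurd (ht ▸ TransGen_mem_left h) x₀C
        · exact ht
    · refine (p.finite_past w hw).subset ?_
      rintro t ⟨ht, htw⟩
      obtain ⟨h1, h2⟩ := transGen_of_closed Rright htw (Or.inr hw)
      refine ⟨?_, h1⟩
      rcases ht with ht | ht
      · exact absurd (ht ▸ h2) x₀C
      · exact ht
  · intro s
    rw [← p.card_init s]
    congr 1
    ext x
    constructor
    · rintro ⟨⟨hx, hx'⟩, hl⟩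
      have hxS : x ∈ p.S := hx.resolve_right fun hxB => hx' x₀ ((x₀R x).2 hxB)
      rw [lab_C x (Or.inl hxS)] at hl
      exact ⟨⟨hxS, fun t ht => hx' t ((hR t x).2 (Or.inl ht))⟩, hl⟩
    · rintro ⟨⟨hx, hx'⟩, hl⟩
      refine ⟨⟨Or.inl hx, fun t ht => hx' t (Rright _ _ (Or.inl hx) ht).1⟩, ?_⟩
      rwa [lab_C x (Or.inl hx)]
  · intro t ht w hw s
    rcases ht with rfl | ht
    · rw [labx₀, Option.some_inj] at hw
      rw [← hw, ← hc s]
      congr 1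
      ext x
      refine (and_congr (Rx₀ x) Iff.rfl).trans (and_congr_right fun hx => ?_)
      rw [lab_C x (AC x hx)]
    · rw [lab_C t (Or.inr ht)] at hw
      rw [← p.card_pre t ht w hw s]
      congr 1
      ext x
      refine (and_congr ⟨fun h => (Rright _ _ (Or.inr ht) h).1, fun h => (hR _ _).2 (Or.inl h)⟩
        Iff.rfl).trans (and_congr_right fun hx => ?_)
      rw [lab_C x (mem_C_left hx)]
  · intro t ht w hw s
    rcases ht with rfl | ht
    · rw [labx₀, Option.some_inj] at hw
      rw [← hw]
      refine encard_fiber he (fun s i => some ⟨s, i⟩) ?_ ?_ ?_ s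
      · intro s i j hij
        simpa using hij
      · intro x
        refine (x₀R x).trans ?_
        rw [hB]
        simp
      · exact fun s i => lab_e _
    · rw [lab_C t (Or.inr ht)] at hw
      rw [← p.card_post t ht w hw s]
      congr 1
      ext x
      refine (and_congr ⟨fun h => RT _ _ ht h, fun h => (hR _ _).2 (Or.inl h)⟩
        Iff.rfl).trans (and_congr_right fun hx => ?_)
      rw [lab_C x (mem_C_right hx)]
  · exact fun x hx => Or.inl hx
  · exact fun x hx => Or.inr hx
  · exact fun x hx => lab_C x hx
  · exact fun h => (hR _ _).2 (Or.inl h)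
  · rintro x y h (hy | hx)
    · exact (Rright _ _ hy h).1
    · exact RT _ _ hx h
  · exact fun h => x₀C (Or.inr h)
  · ext a
    exact Rx₀ a

/-- There is a process without transitions. -/
theorem exists_initial (N : Net U) : Nonempty (Proc N) := by
  obtain ⟨e, he, -⟩ := exists_fresh (Σ s : U, Fin (N.M₀ s)) ∅
  let lab : ZFSet.{u} → Option U := Function.extend e (fun a => some a.1) fun _ => none
  have lab_e : ∀ a, lab (e a) = some a.1 := fun a => he.extend_apply _ _ a
  refine ⟨{
    S := Set.range e
    T := ∅
    R := fun _ _ => False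
    lab := lab
    disj := fun _ _ h => h
    supp := False.elim
    lab_S := ?_
    lab_T := fun _ h => h.elim
    lab_none := ?_
    prod_unique := fun _ _ _ _ h => h.elim
    cons_unique := fun _ _ _ _ h => h.elim
    acyclic := ?_
    finite_past := fun _ h => h.elim
    card_init := ?_
    card_pre := fun _ h => h.elim
    card_post := fun _ h => h.elim }⟩
  · rintro _ ⟨⟨s, i⟩, rfl⟩
    exact ⟨s, N.M₀_support s (by have := i.2; omega), lab_e _⟩
  · intro x hx _
    exact Function.extend_apply' _ _ _ hx
  · intro x hx
    obtain ⟨y, h, -⟩ := TransGen.head'_iff.1 hx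
    exact h
  · refine encard_fiber he (fun s i => ⟨s, i⟩) (fun s i j hij => by simpa using hij) ?_
      fun s i => lab_e _
    intro x
    constructor
    · rintro ⟨⟨⟨s, i⟩, rfl⟩, -⟩
      exact ⟨s, i, rfl⟩
    · rintro ⟨s, i, rfl⟩
      exact ⟨⟨_, rfl⟩, fun _ => id⟩

/-- Chains of processes have upper bounds. -/
theorem exists_upper_bound {c : Set (Proc N)} (hc : IsChain Le c) (hne : c.Nonempty) :
    ∃ q, ∀ p ∈ c, Le p q := by
  classical
  have : Std.Refl (Le (N := N)) := ⟨Le.refl⟩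
  have dir : ∀ p ∈ c, ∀ q ∈ c, ∃ r ∈ c, Le p r ∧ Le q r := by
    intro p hp q hq
    rcases hc.total hp hq with h | h
    · exact ⟨q, hq, h, .refl q⟩
    · exact ⟨p, hp, .refl p, h⟩
  obtain ⟨R, hR⟩ : ∃ R : ZFSet.{u} → ZFSet.{u} → Prop, ∀ x y, R x y ↔ ∃ p ∈ c, p.R x y :=
    ⟨_, fun _ _ => Iff.rfl⟩
  have hlab : ∃ lab : ZFSet.{u} → Option U, (∀ p ∈ c, ∀ x ∈ p.C, lab x = p.lab x) ∧
      ∀ x, (∀ p ∈ c, x ∉ p.C) → lab x = none := by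
    -- The chosen member does not matter, since any two members of the chain have an upper bound in
    -- it with which both labellings agree.
    refine ⟨fun x => if h : ∃ p ∈ c, x ∈ p.C then h.choose.lab x else none, ?_, ?_⟩
    · intro p hp x hx
      have h : ∃ p ∈ c, x ∈ p.C := ⟨p, hp, hx⟩
      refine (dif_pos h).trans ?_
      obtain ⟨r, -, h1, h2⟩ := dir p hp _ h.choose_spec.1
      rw [← h1.lab_eq x hx, ← h2.lab_eq x h.choose_spec.2]
    · intro x hx
      refine dif_neg ?_
      rintro ⟨p, hp, h⟩
      exact hx p hp h
  obtain ⟨lab, lab_C, lab_none⟩ := hlab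
  have back : ∀ p ∈ c, ∀ x y, R x y → y ∈ p.C ∨ x ∈ p.T → p.R x y := by
    intro p hp x y h hxy
    obtain ⟨q, hq, h⟩ := (hR x y).1 h
    obtain ⟨r, -, h1, h2⟩ := dir p hp q hq
    exact h1.back (h2.R_sub h) hxy
  -- Each member is backward closed in the union, so whatever concerns the past of one element can
  -- be checked inside a single member.
  have Rright : ∀ p ∈ c, ∀ a b, b ∈ p.C → R a b → p.R a b ∧ a ∈ p.C := by
    intro p hp a b hb hab
    have := back p hp a b hab (Or.inl hb)
    exact ⟨this, mem_C_left this⟩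
  refine ⟨{
    S := {x | ∃ p ∈ c, x ∈ p.S}
    T := {x | ∃ p ∈ c, x ∈ p.T}
    R := R
    lab := lab
    disj := ?_
    supp := ?_
    lab_S := ?_
    lab_T := ?_
    lab_none := ?_
    prod_unique := ?_
    cons_unique := ?_
    acyclic := ?_
    finite_past := ?_
    card_init := ?_
    card_pre := ?_
    card_post := ?_ }, fun p hp => ⟨?_, ?_, ?_, ?_, ?_⟩⟩
  · rintro x ⟨p, hp, hx⟩ ⟨q, hq, hx'⟩
    obtain ⟨r, -, h1, h2⟩ := dir p hp q hq
    exact r.disj x (h1.S_sub hx) (h2.T_sub hx')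
  · intro x y h
    obtain ⟨p, hp, h⟩ := (hR x y).1 h
    exact (p.supp h).imp (fun h => ⟨⟨p, hp, h.1⟩, ⟨p, hp, h.2⟩⟩)
      fun h => ⟨⟨p, hp, h.1⟩, ⟨p, hp, h.2⟩⟩
  · rintro x ⟨p, hp, hx⟩
    rw [lab_C p hp x (Or.inl hx)]
    exact p.lab_S x hx
  · rintro x ⟨p, hp, hx⟩
    rw [lab_C p hp x (Or.inr hx)]
    exact p.lab_T x hx
  · intro x hx hx'
    refine lab_none x fun p hp h => ?_
    rcases h with h | h
    · exact hx ⟨p, hp, h⟩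
    · exact hx' ⟨p, hp, h⟩
  · rintro s ⟨p, hp, hs⟩ t t' h h'
    exact p.prod_unique s hs t t' (Rright p hp _ _ (Or.inl hs) h).1 (Rright p hp _ _ (Or.inl hs) h').1
  · rintro s ⟨p, hp, hs⟩ t t' h h'
    obtain ⟨q, hq, h⟩ := (hR _ _).1 h
    obtain ⟨q', hq', h'⟩ := (hR _ _).1 h'
    obtain ⟨r, hr, h1, h2⟩ := dir q hq q' hq'
    obtain ⟨r', -, h3, h4⟩ := dir p hp r hr
    exact r'.cons_unique s (h3.S_sub hs) t t' (h4.R_sub (h1.R_sub h)) (h4.R_sub (h2.R_sub h'))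
  · intro x hx
    obtain ⟨y, -, h⟩ := TransGen.tail'_iff.1 hx
    obtain ⟨p, hp, h⟩ := (hR _ _).1 h
    exact p.acyclic x (transGen_of_closed (Rright p hp) hx (mem_C_right h)).1
  · rintro v ⟨p, hp, hv⟩
    refine (p.finite_past v hv).subset ?_
    rintro t ⟨⟨q, hq, ht⟩, htv⟩
    obtain ⟨h1, h2⟩ := transGen_of_closed (Rright p hp) htv (Or.inr hv)
    refine ⟨?_, h1⟩
    rcases h2 with h2 | h2
    · obtain ⟨r, -, h3, h4⟩ := dir p hp q hq
      exact absurd (h4.T_sub ht) (r.disj t (h3.S_sub h2))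
    · exact h2
  · intro s
    obtain ⟨p, hp⟩ := hne
    rw [← p.card_init s]
    congr 1
    ext x
    constructor
    · rintro ⟨⟨⟨q, hq, hx⟩, hx'⟩, hl⟩
      obtain ⟨r, hr, h1, h2⟩ := dir p hp q hq
      have hxr : x ∈ r.I := ⟨h2.S_sub hx, fun t ht => hx' t ((hR _ _).2 ⟨r, hr, ht⟩)⟩
      rw [← h1.I_eq] at hxr
      rw [lab_C p hp x (Or.inl hxr.1)] at hl
      exact ⟨hxr, hl⟩
    · rintro ⟨⟨hx, hx'⟩, hl⟩
      refine ⟨⟨⟨p, hp, hx⟩, fun t ht => hx' t (Rright p hp _ _ (Or.inl hx) ht).1⟩, ?_⟩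
      rwa [lab_C p hp x (Or.inl hx)]
  · rintro t ⟨p, hp, ht⟩ w hw s
    rw [lab_C p hp t (Or.inr ht)] at hw
    rw [← p.card_pre t ht w hw s]
    congr 1
    ext x
    refine (and_congr ⟨fun h => back p hp _ _ h (Or.inl (Or.inr ht)),
      fun h => (hR _ _).2 ⟨p, hp, h⟩⟩ Iff.rfl).trans (and_congr_right fun hx => ?_)
    rw [lab_C p hp x (mem_C_left hx)]
  · rintro t ⟨p, hp, ht⟩ w hw s
    rw [lab_C p hp t (Or.inr ht)] at hw
    rw [← p.card_post t ht w hw s]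
    congr 1
    ext x
    refine (and_congr ⟨fun h => back p hp _ _ h (Or.inr ht),
      fun h => (hR _ _).2 ⟨p, hp, h⟩⟩ Iff.rfl).trans (and_congr_right fun hx => ?_)
    rw [lab_C p hp x (mem_C_right hx)]
  · exact fun x hx => ⟨p, hp, hx⟩
  · exact fun x hx => ⟨p, hp, hx⟩
  · exact lab_C p hp
  · exact fun h => (hR _ _).2 ⟨p, hp, h⟩
  · exact fun h => back p hp _ _ h

/-- `p` has no proper extension. -/
def Maximal (p : Proc N) : Prop := ∀ q, Le p q → q = p

theorem exists_maximal (N : Net U) : ∃ p : Proc N, p.Maximal := by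
  have := exists_initial N
  obtain ⟨m, hm⟩ := exists_maximal_of_nonempty_chains_bounded (r := Le (N := N))
    (fun c hc hne => exists_upper_bound hc hne) fun h h' => h.trans h'
  exact ⟨m, fun q hq => (hm q hq).antisymm hq⟩

end Proc

/-! ### The structure of one-transition extensions. -/

namespace Proc

variable {U : Type u} {N : Net U} {p q r p' q' : Proc N}

namespace Ext

variable {x y : ZFSet.{u}} {v : U} {A B : Set ZFSet.{u}}

theorem mem_T (h : Ext p q x v A) : x ∈ q.T := h.T_eq ▸ Set.mem_insert x _

theorem label_mem (h : Ext p q x v A) : v ∈ N.T := by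
  obtain ⟨w, hw, h'⟩ := q.lab_T x h.mem_T
  rw [h.lab_eq, Option.some_inj] at h'
  exact h' ▸ hw

theorem notMem_C (h : Ext p q x v A) : x ∉ p.C := fun hx =>
  hx.elim (fun hx => q.disj x (h.le.S_sub hx) h.mem_T) h.notMem

theorem post_notMem (h : Ext p q x v A) {y} (hy : y ∈ q.post x) : y ∉ p.C := by
  intro hyC
  exact h.notMem_C (mem_C_left (h.le.back hy (Or.inl hyC)))

theorem S_eq (h : Ext p q x v A) : q.S = p.S ∪ q.post x := by
  ext y
  refine ⟨fun hy => ?_, fun hy => hy.elim (fun hy => h.le.S_sub hy) (mem_S_of_post h.mem_T)⟩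
  by_cases hp : ∃ t, q.R t y
  · obtain ⟨t, ht⟩ := hp
    have htT := mem_T_of_prod hy ht
    rw [h.T_eq] at htT
    rcases htT with rfl | htT
    · exact Or.inr ht
    · exact Or.inl (mem_S_of_post htT (h.le.back ht (Or.inr htT)))
  · have : y ∈ q.I := ⟨hy, fun t ht => hp ⟨t, ht⟩⟩
    rw [← h.le.I_eq] at this
    exact Or.inl this.1

/-- A preplace of `x` is not a postplace of `x` by acyclicity, so it is old; an old consumer would
coincide with `x`, which is new. -/
theorem sub_E (h : Ext p q x v A) : A ⊆ p.E := by
  intro a ha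
  rw [← h.pre_eq] at ha
  have haS : a ∈ q.S := mem_S_of_pre h.mem_T ha
  constructor
  · rw [h.S_eq] at haS
    refine haS.resolve_right fun hpost => q.acyclic x ?_
    exact (TransGen.single hpost).tail ha
  · intro t ht
    obtain rfl := q.cons_unique a haS _ _ ha (h.le.R_sub ht)
    exact h.notMem_C (mem_C_right ht)

theorem R_iff (h : Ext p q x v A) {a b} :
    q.R a b ↔ p.R a b ∨ (a ∈ A ∧ b = x) ∨ (a = x ∧ b ∈ q.post x) := by
  constructor
  · intro hR
    rcases q.supp hR with ⟨-, hb⟩ | ⟨ha, -⟩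
    · rw [h.T_eq] at hb
      rcases hb with rfl | hb
      · exact Or.inr (Or.inl ⟨h.pre_eq ▸ hR, rfl⟩)
      · exact Or.inl (h.le.back hR (Or.inl (Or.inr hb)))
    · rw [h.T_eq] at ha
      rcases ha with rfl | ha
      · exact Or.inr (Or.inr ⟨rfl, hR⟩)
      · exact Or.inl (h.le.back hR (Or.inr ha))
  · rintro (hR | ⟨ha, rfl⟩ | ⟨rfl, hb⟩)
    · exact h.le.R_sub hR
    · rw [← h.pre_eq] at ha
      exact ha
    · exact hb

theorem mem_C_iff (h : Ext p q x v A) {z} : z ∈ q.C ↔ z ∈ p.C ∨ z = x ∨ z ∈ q.post x := by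
  rw [C, h.S_eq, h.T_eq, C]
  simp only [Set.mem_union, Set.mem_insert_iff]
  tauto

theorem E_eq (h : Ext p q x v A) : q.E = (p.E \ A) ∪ q.post x := by
  ext y
  constructor
  · rintro ⟨hy, hy'⟩
    rw [h.S_eq] at hy
    refine hy.imp_left fun hy => ⟨⟨hy, fun t ht => hy' t (h.le.R_sub ht)⟩, fun hA => ?_⟩
    exact hy' x (h.R_iff.2 (Or.inr (Or.inl ⟨hA, rfl⟩)))
  · rintro (⟨hy, hyA⟩ | hy)
    · refine ⟨h.le.S_sub hy.1, fun t ht => ?_⟩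
      rcases h.R_iff.1 ht with h' | h' | h'
      · exact hy.2 t h'
      · exact hyA h'.1
      · exact h.notMem_C (h'.1 ▸ Or.inl hy.1)
    · refine ⟨mem_S_of_post h.mem_T hy, fun t ht => ?_⟩
      rcases h.R_iff.1 ht with h' | h' | h'
      · exact h.post_notMem hy (mem_C_left h')
      · exact h.post_notMem hy (Or.inl (h.sub_E h'.1).1)
      · exact q.disj y (mem_S_of_post h.mem_T hy) (h'.1 ▸ h.mem_T)

theorem card_eq (h : Ext p q x v A) (s : U) :
    {a | a ∈ A ∧ p.lab a = some s}.encard = N.F s v := by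
  rw [← q.card_pre x h.mem_T v h.lab_eq s]
  congr 1
  ext a
  have : q.R a x ↔ a ∈ A := by rw [← h.pre_eq]; rfl
  refine (and_congr this.symm Iff.rfl).trans (and_congr_right fun ha => ?_)
  rw [h.le.lab_eq a (Or.inl (h.sub_E (this.1 ha)).1)]

theorem card_post (h : Ext p q x v A) (s : U) :
    {a | a ∈ q.post x ∧ q.lab a = some s}.encard = N.F v s :=
  q.card_post x h.mem_T v h.lab_eq s

theorem label_pos (h : Ext p q x v A) {a : ZFSet.{u}} (ha : a ∈ A) {s : U}
    (hs : p.lab a = some s) : 0 < N.F s v := by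
  have h1 := h.card_eq s
  by_contra h0
  rw [Nat.pos_iff_ne_zero, not_not] at h0
  rw [h0, Nat.cast_zero, Set.encard_eq_zero] at h1
  exact (Set.ext_iff.1 h1 a).1 ⟨ha, hs⟩

/-- Two sets of preplaces of equally labelled transitions have the same labels. -/
theorem exists_mem_diff (h : Ext p q x v A) (h' : Ext p r y v B) {a} (ha : a ∈ A) (haB : a ∉ B) :
    ∃ b ∈ B, b ∉ A ∧ p.lab a = p.lab b := by
  by_contra hcon
  push Not at hcon
  obtain ⟨s, -, hs⟩ := p.lab_S a (h.sub_E ha).1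
  have hfin : {b | b ∈ B ∧ p.lab b = some s}.Finite := Set.finite_of_encard_eq_coe (h'.card_eq s)
  have heq := hfin.eq_of_subset_of_encard_le (t := {a | a ∈ A ∧ p.lab a = some s})
    (fun b hb => ⟨by_contra fun hbA => hcon b hb.1 hbA (hs.trans hb.2.symm), hb.2⟩)
    ((h.card_eq s).trans (h'.card_eq s).symm).le
  exact haB ((Set.ext_iff.1 heq a).2 ⟨ha, hs⟩).1

end Ext

/-! ### Isomorphisms -/

/-- `φ` restricts to an isomorphism from `p` to `q`. -/
structure IsIso (p q : Proc N) (φ : ZFSet.{u} → ZFSet.{u}) : Prop where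
  bijS : Set.BijOn φ p.S q.S
  bijT : Set.BijOn φ p.T q.T
  rel : ∀ x ∈ p.C, ∀ y ∈ p.C, q.R (φ x) (φ y) ↔ p.R x y
  lab : ∀ x ∈ p.C, q.lab (φ x) = p.lab x

theorem bijOn_union {s s' t t' : Set ZFSet.{u}} {f : ZFSet.{u} → ZFSet.{u}}
    (h : Set.BijOn f s t) (h' : Set.BijOn f s' t') (hd : ∀ x ∈ t, x ∉ t') :
    Set.BijOn f (s ∪ s') (t ∪ t') := by
  refine h.union h' ?_
  rintro x (hx | hx) y (hy | hy) hxy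
  · exact h.injOn hx hy hxy
  · exact absurd (hxy ▸ h'.mapsTo hy) (hd _ (h.mapsTo hx))
  · exact absurd (hxy ▸ h'.mapsTo hx) (hd _ (h.mapsTo hy))
  · exact h'.injOn hx hy hxy

namespace IsIso

variable {φ : ZFSet.{u} → ZFSet.{u}}

theorem refl (p : Proc N) : IsIso p p id :=
  ⟨Set.bijOn_id _, Set.bijOn_id _, fun _ _ _ _ => Iff.rfl, fun _ _ => rfl⟩

theorem bijC (h : IsIso p q φ) : Set.BijOn φ p.C q.C := bijOn_union h.bijS h.bijT q.disj

theorem symm (h : IsIso p q φ) : ∃ ψ, IsIso q p ψ ∧ ∀ x ∈ p.C, ψ (φ x) = x := by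
  have hb := h.bijC
  let ψ := Function.invFunOn φ p.C
  have hψ : Set.InvOn ψ φ p.C q.C := hb.invOn_invFunOn
  have hl : ∀ x ∈ p.C, ψ (φ x) = x := hψ.1
  have hr : ∀ y ∈ q.C, φ (ψ y) = y := hψ.2
  have hC : ∀ y ∈ q.C, ψ y ∈ p.C := by
    intro y hy
    obtain ⟨x, hx, rfl⟩ := hb.surjOn hy
    rwa [hl x hx]
  have key : ∀ {s t : Set ZFSet.{u}}, s ⊆ p.C → t ⊆ q.C → Set.BijOn φ s t → Set.BijOn ψ t s := by
    intro s t hs ht hst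
    refine ⟨?_, ?_, ?_⟩
    · intro y hy
      obtain ⟨x, hx, rfl⟩ := hst.surjOn hy
      rwa [hl x (hs hx)]
    · intro y hy y' hy' hyy
      rw [← hr y (ht hy), hyy, hr y' (ht hy')]
    · intro x hx
      exact ⟨φ x, hst.mapsTo hx, hl x (hs hx)⟩
  refine ⟨ψ, ⟨key Set.subset_union_left Set.subset_union_left h.bijS,
    key Set.subset_union_right Set.subset_union_right h.bijT, ?_, ?_⟩, hl⟩
  · intro x hx y hy
    rw [← h.rel _ (hC x hx) _ (hC y hy), hr x hx, hr y hy]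
  · intro x hx
    rw [← h.lab _ (hC x hx), hr x hx]

theorem transGen (h : IsIso p q φ) {x y} (hxy : TransGen p.R x y) :
    TransGen q.R (φ x) (φ y) := by
  induction hxy with
  | single hR => exact .single ((h.rel _ (mem_C_left hR) _ (mem_C_right hR)).2 hR)
  | tail _ hR ih => exact ih.tail ((h.rel _ (mem_C_left hR) _ (mem_C_right hR)).2 hR)

theorem transGen_iff (h : IsIso p q φ) {x y} (hx : x ∈ p.C) (hy : y ∈ p.C) :
    TransGen q.R (φ x) (φ y) ↔ TransGen p.R x y := by
  refine ⟨fun hxy => ?_, h.transGen⟩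
  obtain ⟨ψ, hψ, hl⟩ := h.symm
  have := hψ.transGen hxy
  rwa [hl x hx, hl y hy] at this

end IsIso

/-- Sets with the same finite label counts are in label-preserving bijection. -/
theorem exists_bijOn_lab {A B : Set ZFSet.{u}} {labA labB : ZFSet.{u} → Option U} {f : U → ℕ}
    (hlA : ∀ x ∈ A, ∃ s, labA x = some s) (hlB : ∀ x ∈ B, ∃ s, labB x = some s)
    (hA : ∀ s, {x | x ∈ A ∧ labA x = some s}.encard = f s)
    (hB : ∀ s, {x | x ∈ B ∧ labB x = some s}.encard = f s) :
    ∃ ψ : ZFSet.{u} → ZFSet.{u}, Set.BijOn ψ A B ∧ ∀ x ∈ A, labB (ψ x) = labA x := by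
  have h : ∀ s, ∃ g : ZFSet.{u} → ZFSet.{u},
      Set.BijOn g {x | x ∈ A ∧ labA x = some s} {x | x ∈ B ∧ labB x = some s} := fun s =>
    (Set.finite_of_encard_eq_coe (hA s)).exists_bijOn_of_encard_eq ((hA s).trans (hB s).symm)
  choose g hg using h
  let ψ : ZFSet.{u} → ZFSet.{u} := fun x => (labA x).elim x fun s => g s x
  have hψ : ∀ x s, labA x = some s → ψ x = g s x := fun x s hs => by
    simp only [ψ, hs, Option.elim_some]
  have hl : ∀ x ∈ A, labB (ψ x) = labA x := by
    intro x hx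
    obtain ⟨s, hs⟩ := hlA x hx
    rw [hψ x s hs, hs]
    exact ((hg s).mapsTo ⟨hx, hs⟩).2
  refine ⟨ψ, ⟨?_, ?_, ?_⟩, hl⟩
  · intro x hx
    obtain ⟨s, hs⟩ := hlA x hx
    rw [hψ x s hs]
    exact ((hg s).mapsTo ⟨hx, hs⟩).1
  · intro x hx y hy hxy
    have hlxy : labA x = labA y := by rw [← hl x hx, ← hl y hy, hxy]
    obtain ⟨s, hs⟩ := hlA x hx
    rw [hψ x s hs, hψ y s (hlxy ▸ hs)] at hxy
    exact (hg s).injOn ⟨hx, hs⟩ ⟨hy, hlxy ▸ hs⟩ hxy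
  · intro y hy
    obtain ⟨s, hs⟩ := hlB y hy
    obtain ⟨x, hx, rfl⟩ := (hg s).surjOn ⟨hy, hs⟩
    exact ⟨x, hx.1, hψ x s hx.2⟩

/-- Isomorphisms lift to corresponding one-transition extensions. -/
theorem IsIso.ext {φ : ZFSet.{u} → ZFSet.{u}} (hφ : IsIso p p' φ) {x x' : ZFSet.{u}} {v : U}
    {A : Set ZFSet.{u}} (h : Ext p q x v A) (h' : Ext p' q' x' v (φ '' A)) :
    ∃ φ', IsIso q q' φ' := by
  classical
  have hlab : ∀ {r r' : Proc N} {y : ZFSet.{u}} {B : Set ZFSet.{u}}, Ext r r' y v B →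
      ∀ z ∈ r'.post y, ∃ s, r'.lab z = some s := by
    intro r r' y B hr z hz
    obtain ⟨s, -, hs⟩ := r'.lab_S z (mem_S_of_post hr.mem_T hz)
    exact ⟨s, hs⟩
  obtain ⟨ψ, hψ, hψl⟩ := exists_bijOn_lab (hlab h) (hlab h') h.card_post h'.card_post
  let φ' : ZFSet.{u} → ZFSet.{u} := fun z => if z ∈ p.C then φ z else if z = x then x' else ψ z
  have φC : ∀ z ∈ p.C, φ' z = φ z := fun z hz => if_pos hz
  have φx : φ' x = x' := (if_neg h.notMem_C).trans (if_pos rfl)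
  have φpost : ∀ z ∈ q.post x, φ' z = ψ z := fun z hz => by
    refine (if_neg (h.post_notMem hz)).trans (if_neg ?_)
    rintro rfl
    exact q.acyclic z (.single hz)
  have maps : ∀ z ∈ p.C, φ z ∈ p'.C := hφ.bijC.mapsTo
  have x'post : x' ∉ q'.post x' := fun hz => q'.acyclic x' (.single hz)
  have e1 : ∀ z ∈ q.C, φ' z ∈ p'.C → z ∈ p.C := by
    intro z hz hz'
    rcases h.mem_C_iff.1 hz with h1 | rfl | h1
    · exact h1
    · exact absurd (φx ▸ hz') h'.notMem_C
    · exact absurd hz' (φpost z h1 ▸ h'.post_notMem (hψ.mapsTo h1))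
  have e2 : ∀ z ∈ q.C, φ' z = x' ↔ z = x := by
    intro z hz
    refine ⟨fun he => ?_, fun he => he ▸ φx⟩
    rcases h.mem_C_iff.1 hz with h1 | rfl | h1
    · exact absurd (he ▸ φC z h1 ▸ maps z h1) h'.notMem_C
    · rfl
    · have h2 := hψ.mapsTo h1
      rw [← φpost z h1, he] at h2
      exact absurd h2 x'post
  have e3 : ∀ z ∈ q.C, φ' z ∈ q'.post x' ↔ z ∈ q.post x := by
    intro z hz
    refine ⟨fun he => ?_, fun he => φpost z he ▸ hψ.mapsTo he⟩
    rcases h.mem_C_iff.1 hz with h1 | rfl | h1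
    · exact absurd (φC z h1 ▸ maps z h1) (h'.post_notMem he)
    · exact absurd (φx ▸ he) x'post
    · exact h1
  have AC : ∀ z ∈ A, z ∈ p.C := fun z hz => Or.inl (h.sub_E hz).1
  have e4 : ∀ z ∈ q.C, φ' z ∈ φ '' A ↔ z ∈ A := by
    intro z hz
    refine ⟨?_, fun hA => ⟨z, hA, (φC z (AC z hA)).symm⟩⟩
    rintro ⟨a, ha, hza⟩
    have hzC : z ∈ p.C := e1 z hz (hza ▸ maps a (AC a ha))
    rw [φC z hzC] at hza
    rwa [← hφ.bijC.injOn (AC a ha) hzC hza]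
  refine ⟨φ', ⟨?_, ?_, ?_, ?_⟩⟩
  · rw [h.S_eq, h'.S_eq]
    refine bijOn_union (hφ.bijS.congr fun z hz => (φC z (Or.inl hz)).symm)
      (hψ.congr fun z hz => (φpost z hz).symm) fun z hz hz' => h'.post_notMem hz' (Or.inl hz)
  · rw [h.T_eq, h'.T_eq, Set.insert_eq, Set.insert_eq]
    refine bijOn_union (by rw [Set.bijOn_singleton]; exact φx)
      (hφ.bijT.congr fun z hz => (φC z (Or.inr hz)).symm) fun z hz hz' => h'.notMem (hz ▸ hz')
  · intro a ha b hb
    rw [h.R_iff, h'.R_iff, e4 a ha, e2 b hb, e2 a ha, e3 b hb]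
    refine or_congr_left ⟨fun hR => ?_, fun hR => ?_⟩
    · have ha' := e1 a ha (mem_C_left hR)
      have hb' := e1 b hb (mem_C_right hR)
      rw [φC a ha', φC b hb'] at hR
      exact (hφ.rel a ha' b hb').1 hR
    · rw [φC a (mem_C_left hR), φC b (mem_C_right hR)]
      exact (hφ.rel a (mem_C_left hR) b (mem_C_right hR)).2 hR
  · intro z hz
    rcases h.mem_C_iff.1 hz with h1 | rfl | h1
    · rw [φC z h1, h'.le.lab_eq _ (maps z h1), hφ.lab z h1, h.le.lab_eq z h1]
    · rw [φx, h'.lab_eq, h.lab_eq]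
    · rw [φpost z h1, hψl z h1]

/-- Extensions transport along isomorphisms. -/
theorem IsIso.exists_ext {φ : ZFSet.{u} → ZFSet.{u}} (hφ : IsIso p p' φ) {x : ZFSet.{u}} {v : U}
    {A : Set ZFSet.{u}} (h : Ext p q x v A) :
    ∃ q' x', Ext p' q' x' v (φ '' A) ∧ ∃ φ', IsIso q q' φ' := by
  have AC : ∀ z ∈ A, z ∈ p.C := fun z hz => Or.inl (h.sub_E hz).1
  have h1 : φ '' A ⊆ p'.E := by
    rintro _ ⟨a, ha, rfl⟩
    refine ⟨hφ.bijS.mapsTo (h.sub_E ha).1, fun t ht => ?_⟩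
    obtain ⟨w, hw, rfl⟩ := hφ.bijC.surjOn (mem_C_right ht)
    exact (h.sub_E ha).2 w ((hφ.rel a (AC a ha) w hw).1 ht)
  have h2 : ∀ s, {x | x ∈ φ '' A ∧ p'.lab x = some s}.encard = N.F s v := by
    intro s
    rw [← h.card_eq s, ← Set.InjOn.encard_image (s := {a | a ∈ A ∧ p.lab a = some s}) (f := φ)
      (hφ.bijC.injOn.mono fun a ha => AC a ha.1)]
    congr 1
    ext z
    constructor
    · rintro ⟨⟨a, ha, rfl⟩, hl⟩
      exact ⟨a, ⟨ha, (hφ.lab a (AC a ha)).symm.trans hl⟩, rfl⟩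
    · rintro ⟨a, ⟨ha, hl⟩, rfl⟩
      exact ⟨⟨a, ha, rfl⟩, (hφ.lab a (AC a ha)).trans hl⟩
  obtain ⟨q', x', h'⟩ := Proc.exists_ext p' h.label_mem h1 h2
  exact ⟨q', x', h', hφ.ext h h'⟩

/-! ### Swapping equivalence of finite processes -/

/-- `q` is isomorphic to the result of a swap in `p`. -/
def OneStep (p q : Proc N) : Prop := ∃ (a b : ZFSet.{u}) (h : p.Unrel a b) (φ : _),
  IsIso (p.swap h) q φ

/-- The reflexive and transitive closure of one step swapping equivalence. -/
def Star : Proc N → Proc N → Prop := ReflTransGen OneStep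

theorem swap_self {a : ZFSet.{u}} (h : p.Unrel a a) : p.swap h = p := by
  refine Proc.ext rfl rfl ?_ rfl
  ext x y
  simp [swap]

/-- Every swapping step includes an isomorphism, so swapping a place with itself suffices. Without
places there are no transitions either, and the two processes are equal. -/
theorem IsIso.star {φ : ZFSet.{u} → ZFSet.{u}} (h : IsIso p q φ) : Star p q := by
  by_cases hS : p.S.Nonempty
  · obtain ⟨a, ha⟩ := hS
    have hu : p.Unrel a a := ⟨ha, ha, p.acyclic a, p.acyclic a, rfl⟩
    exact .single ⟨a, a, hu, φ, by rwa [swap_self hu]⟩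
  · have key : ∀ r : Proc N, r.S = ∅ → r.T = ∅ := by
      intro r hr
      refine Set.eq_empty_of_forall_notMem fun t ht => ?_
      obtain ⟨x, hx⟩ := pre_nonempty ht
      exact absurd (mem_S_of_pre ht hx) (hr ▸ Set.notMem_empty x)
    have hp : p.S = ∅ := Set.not_nonempty_iff_eq_empty.1 hS
    have hq : q.S = ∅ := by rw [← h.bijS.image_eq, hp, Set.image_empty]
    have h0 : Le p q :=
      { S_sub := by rw [hp]; exact Set.empty_subset _
        T_sub := by rw [key p hp]; exact Set.empty_subset _
        lab_eq := fun x hx => by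
          rw [C, hp, key p hp, Set.union_empty] at hx
          exact hx.elim
        R_sub := fun hR => by
          have := mem_C_left hR
          rw [C, hp, key p hp, Set.union_empty] at this
          exact this.elim
        back := fun hR => by
          have := mem_C_left hR
          rw [C, hq, key q hq, Set.union_empty] at this
          exact this.elim }
    rw [h0.eq_of_T_sub (by rw [key q hq]; exact Set.empty_subset _)]
    exact .refl

/-- Swapping `φ a` and `φ b` undoes the swap of `a` and `b`; unrelatedness survives a swap by
`transGen_swap`. -/
theorem OneStep.symm (h : OneStep p q) : OneStep q p := by
  classical
  obtain ⟨a, b, h, φ, hφ⟩ := h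
  have haC : a ∈ (p.swap h).C := Or.inl h.ha
  have hbC : b ∈ (p.swap h).C := Or.inl h.hb
  have hu : q.Unrel (φ a) (φ b) := by
    refine ⟨hφ.bijS.mapsTo h.ha, hφ.bijS.mapsTo h.hb, ?_, ?_, ?_⟩
    · rw [hφ.transGen_iff haC hbC]
      intro h'
      rcases transGen_swap h.hab h.hba h' with h' | h' | h'
      · exact h.hab h'
      · exact p.acyclic _ h'.2
      · exact h.hab h'.2
    · rw [hφ.transGen_iff hbC haC]
      intro h'
      rcases transGen_swap h.hab h.hba h' with h' | h' | h'
      · exact h.hba h'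
      · exact h.hba h'.2
      · exact p.acyclic _ h'.2
    · rw [hφ.lab a haC, hφ.lab b hbC]
      exact h.hl
  have hsw : ∀ x ∈ p.C, Equiv.swap (φ a) (φ b) (φ x) = φ (Equiv.swap a b x) := by
    intro x hx
    rcases eq_or_ne x a with rfl | hxa
    · simp
    rcases eq_or_ne x b with rfl | hxb
    · simp
    rw [Equiv.swap_apply_of_ne_of_ne hxa hxb, Equiv.swap_apply_of_ne_of_ne]
    · exact fun he => hxa (hφ.bijC.injOn hx haC he)
    · exact fun he => hxb (hφ.bijC.injOn hx hbC he)
  have hswC : ∀ x ∈ p.C, Equiv.swap a b x ∈ p.C := by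
    rintro x (hx | hx)
    · exact Or.inl ((swap_mem_S h.ha h.hb).2 hx)
    · rw [swap_of_mem_T h.ha h.hb hx]
      exact Or.inr hx
  have hiso : IsIso p (q.swap hu) φ := by
    refine ⟨hφ.bijS, hφ.bijT, fun x hx y hy => ?_, hφ.lab⟩
    change q.R (Equiv.swap (φ a) (φ b) (φ x)) (φ y) ↔ _
    rw [hsw x hx]
    refine (hφ.rel _ (hswC x hx) y hy).trans ?_
    change p.R (Equiv.swap a b (Equiv.swap a b x)) y ↔ _
    rw [Equiv.swap_apply_self]
  obtain ⟨ψ, hψ, -⟩ := hiso.symm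
  exact ⟨φ a, φ b, hu, ψ, hψ⟩

theorem Star.symm (h : Star p q) : Star q p := by
  induction h with
  | refl => exact .refl
  | tail _ h ih => exact ih.head h.symm

/-- A path of `q` ending in the prefix lies inside the prefix, so extensions create no new causality
between old places. -/
theorem Le.unrel (h : Le p q) {a b : ZFSet.{u}} (hu : p.Unrel a b) : q.Unrel a b where
  ha := h.S_sub hu.ha
  hb := h.S_sub hu.hb
  hab h' := hu.hab (h.transGen h' (Or.inl hu.hb))
  hba h' := hu.hba (h.transGen h' (Or.inl hu.ha))
  hl := by rw [h.lab_eq a (Or.inl hu.ha), h.lab_eq b (Or.inl hu.hb), hu.hl]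

theorem Le.swap (h : Le p q) {a b : ZFSet.{u}} (hu : p.Unrel a b) :
    Le (p.swap hu) (q.swap (h.unrel hu)) where
  S_sub := h.S_sub
  T_sub := h.T_sub
  lab_eq := h.lab_eq
  R_sub hR := h.R_sub hR
  back := by
    intro x y hR hxy
    refine h.back hR (hxy.imp id fun hx => ?_)
    rwa [swap_of_mem_T (p := p) hu.ha hu.hb hx]

/-- Single-transition extensions lift along one step swapping equivalence. -/
theorem OneStep.lift (h : OneStep p p') {x : ZFSet.{u}} {v : U} {A : Set ZFSet.{u}}
    (hq : Ext p q x v A) : ∃ q' x' A', Ext p' q' x' v A' ∧ OneStep q q' := by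
  obtain ⟨a, b, h, φ, hφ⟩ := h
  have he : Ext (p.swap h) (q.swap (hq.le.unrel h)) x v ((q.swap (hq.le.unrel h)).pre x) :=
    ⟨hq.le.swap h, hq.notMem, hq.T_eq, hq.lab_eq, rfl⟩
  obtain ⟨q', x', h', φ', hφ'⟩ := hφ.exists_ext he
  exact ⟨q', x', _, h', a, b, _, φ', hφ'⟩

theorem Star.lift (h : Star p p') {x : ZFSet.{u}} {v : U} {A : Set ZFSet.{u}}
    (hq : Ext p q x v A) : ∃ q' x' A', Ext p' q' x' v A' ∧ Star q q' := by
  induction h with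
  | refl => exact ⟨q, x, A, hq, .refl⟩
  | tail _ h ih =>
    obtain ⟨q₁, x₁, A₁, h₁, h₂⟩ := ih
    obtain ⟨q₂, x₂, A₂, h₃, h₄⟩ := h.lift h₁
    exact ⟨q₂, x₂, A₂, h₃, h₂.tail h₄⟩

theorem not_transGen_of_mem_E {a b : ZFSet.{u}} (ha : a ∈ p.E) : ¬ TransGen p.R a b := fun h => by
  obtain ⟨c, h, -⟩ := TransGen.head'_iff.1 h
  exact ha.2 c h

open Classical in
/-- Exchanging preplaces of the last transition. -/
theorem Ext.swap {x : ZFSet.{u}} {v : U} {A : Set ZFSet.{u}} (h : Ext p q x v A) {a b : ZFSet.{u}}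
    (ha : a ∈ p.E) (hb : b ∈ p.E) (hl : p.lab a = p.lab b) :
    ∃ q', OneStep q q' ∧ Ext p q' x v {z | Equiv.swap a b z ∈ A} := by
  -- A path of `q` between these places would be a path of `p`, but neither has a consumer there.
  have hu : q.Unrel a b := by
    refine ⟨h.le.S_sub ha.1, h.le.S_sub hb.1, ?_, ?_, ?_⟩
    · exact fun h' => not_transGen_of_mem_E ha (h.le.transGen h' (Or.inl hb.1))
    · exact fun h' => not_transGen_of_mem_E hb (h.le.transGen h' (Or.inl ha.1))
    · rw [h.le.lab_eq a (Or.inl ha.1), h.le.lab_eq b (Or.inl hb.1), hl]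
  have hsw : ∀ {z}, z ∉ p.E → Equiv.swap a b z = z := fun hz =>
    Equiv.swap_apply_of_ne_of_ne (fun he => hz (he ▸ ha)) fun he => hz (he ▸ hb)
  have hR : ∀ {z w}, p.R z w → z ∉ p.E := fun hR hE => hE.2 _ hR
  refine ⟨q.swap hu, ⟨a, b, hu, id, .refl _⟩, ⟨h.le.S_sub, h.le.T_sub, h.le.lab_eq, ?_, ?_⟩,
    h.notMem, h.T_eq, h.lab_eq, ?_⟩
  · intro z w hzw
    change q.R (Equiv.swap a b z) w
    rw [hsw (hR hzw)]
    exact h.le.R_sub hzw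
  · rintro z w hzw (hw | hz)
    · have h1 := h.le.back hzw (Or.inl hw)
      have h2 := hsw (hR h1)
      rw [Equiv.swap_apply_self] at h2
      rwa [← h2] at h1
    · refine h.le.back ?_ (Or.inr hz)
      have h2 : Equiv.swap a b z = z := hsw fun hE => p.disj z hE.1 hz
      exact h2 ▸ hzw
  · ext z
    change q.R (Equiv.swap a b z) x ↔ _
    rw [← h.pre_eq]
    rfl

/-- Two extensions by equally labelled transitions are swapping equivalent. -/
theorem Ext.star {x y : ZFSet.{u}} {v : U} {A B : Set ZFSet.{u}} (h : Ext p q x v A)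
    (h' : Ext p r y v B) : Star q r := by
  classical
  have Afin : ∀ {q A}, Ext p q x v A → A.Finite := fun h => h.pre_eq ▸ pre_finite h.mem_T
  induction hn : (A \ B).ncard using Nat.strong_induction_on generalizing q A with
  | _ n ih =>
    -- Equal label counts turn inclusion into equality, and then the two extensions are isomorphic.
    by_cases hAB : A ⊆ B
    · have hBA : B ⊆ A := by
        intro b hb
        by_contra hbA
        obtain ⟨a, ha, haB, -⟩ := h'.exists_mem_diff h hb hbA
        exact haB (hAB ha)
      obtain rfl := hAB.antisymm hBA
      obtain ⟨φ, hφ⟩ := (IsIso.refl p).ext h (by rwa [Set.image_id])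
      exact hφ.star
    · obtain ⟨a, ha, haB⟩ := Set.not_subset.1 hAB
      -- Swapping `a` with `b` replaces `a` by `b` among the preplaces, which removes `a` from `A \
      -- B` and adds nothing.
      obtain ⟨b, hb, hbA, hl⟩ := h.exists_mem_diff h' ha haB
      obtain ⟨q', h1, h2⟩ := h.swap (h.sub_E ha) (h'.sub_E hb) hl
      refine (ReflTransGen.single h1).trans (ih _ ?_ h2 rfl)
      rw [← hn]
      refine Set.ncard_lt_ncard ?_ ((Afin h).sdiff)
      have hne : a ∉ {z | Equiv.swap a b z ∈ A} := fun hz => by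
        have hz : Equiv.swap a b a ∈ A := hz
        rw [Equiv.swap_apply_left] at hz
        exact hbA hz
      refine ⟨?_, fun hsub => hne (hsub ⟨ha, haB⟩).1⟩
      rintro z ⟨hz, hzB⟩
      refine ⟨?_, hzB⟩
      have hza : z ≠ a := fun he => hne (he ▸ hz)
      have hzb : z ≠ b := fun he => hzB (he ▸ hb)
      have hz : Equiv.swap a b z ∈ A := hz
      rwa [Equiv.swap_apply_of_ne_of_ne hza hzb] at hz

end Proc

/-! ### Chains of extensions and prefixes up to swapping. -/

namespace Proc

variable {U : Type u} {N : Net U} {p q r p' q' : Proc N}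

/-- `q` extends `p` by one transition. -/
def ExtR (p q : Proc N) : Prop := ∃ x v A, Ext p q x v A

/-- `p` is a prefix of `q` up to swapping. -/
def Sub (p q : Proc N) : Prop := ∃ w, ReflTransGen ExtR p w ∧ Star w q

theorem Star.lift_chain (h : Star p p') (hq : ReflTransGen ExtR p q) :
    ∃ q', ReflTransGen ExtR p' q' ∧ Star q q' := by
  induction hq with
  | refl => exact ⟨p', .refl, h⟩
  | tail _ hq ih =>
    obtain ⟨q₁, h₁, h₂⟩ := ih
    obtain ⟨x, v, A, hq⟩ := hq
    obtain ⟨q₂, x', A', h₃, h₄⟩ := h₂.lift hq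
    exact ⟨q₂, h₁.tail ⟨x', v, A', h₃⟩, h₄⟩

theorem Sub.refl (p : Proc N) : Sub p p := ⟨p, .refl, .refl⟩

theorem Star.sub (h : Star p q) : Sub p q := ⟨p, .refl, h⟩

/-- The swaps in the middle are moved to the end, because extensions lift along swaps. -/
theorem Sub.trans (h : Sub p q) (h' : Sub q r) : Sub p r := by
  obtain ⟨w, h1, h2⟩ := h
  obtain ⟨w', h3, h4⟩ := h'
  obtain ⟨w'', h5, h6⟩ := h2.symm.lift_chain h3
  exact ⟨w'', h1.trans h5, h6.symm.trans h4⟩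

theorem chain_le (h : ReflTransGen ExtR p q) : Le p q := by
  induction h with
  | refl => exact .refl p
  | tail _ h ih =>
    obtain ⟨x, v, A, h⟩ := h
    exact ih.trans h.le

theorem Ext.finite {x v A} (h : Ext p q x v A) (hp : p.T.Finite) : q.T.Finite :=
  h.T_eq ▸ hp.insert x

theorem Le.closed (h : Le p q) : ∀ v ∈ p.T, ∀ t ∈ q.T, TransGen q.R t v → t ∈ p.T := by
  intro v hv t ht htv
  exact (TransGen_mem_left (h.transGen htv (Or.inr hv))).resolve_left
    fun hS => q.disj t (h.S_sub hS) ht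

/-- A transition all of whose preplaces are in a prefix can be added to the prefix. -/
theorem Le.exists_ext (h : Le p q) {x : ZFSet.{u}} (hx : x ∈ q.T) (hxp : x ∉ p.T)
    (hpre : q.pre x ⊆ p.C) {v : U} (hv : q.lab x = some v) :
    ∃ m, Ext p m x v (q.pre x) ∧ Le m q := by
  have hD : insert x p.T ⊆ q.T := Set.insert_subset hx h.T_sub
  have hc : ∀ w ∈ insert x p.T, ∀ t ∈ q.T, TransGen q.R t w → t ∈ insert x p.T := by
    rintro w (rfl | hw) t ht htw
    · obtain ⟨c, h1, h2⟩ := TransGen.tail'_iff.1 htw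
      have hcC : c ∈ p.C := hpre h2
      rcases reflTransGen_iff_eq_or_transGen.1 h1 with rfl | h3
      · exact absurd ht (q.disj _ (mem_S_of_pre hx h2))
      · exact Or.inr ((TransGen_mem_left (h.transGen h3 hcC)).resolve_left
          fun hS => q.disj t (h.S_sub hS) ht)
    · exact Or.inr (h.closed w hw t ht htw)
  have hle := restrict_le q _ hD hc
  refine ⟨q.restrict _ hD hc, ⟨le_restrict h hD hc (Set.subset_insert _ _), hxp, rfl, ?_, ?_⟩, hle⟩
  · rw [← hv]
    exact (hle.lab_eq x (Or.inr (Set.mem_insert x p.T))).symm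
  · ext z
    exact ⟨fun hz => hz.1, fun hz => ⟨hz, Or.inr (Set.mem_insert x p.T)⟩⟩

/-- A causally minimal missing transition has all its preplaces in `p`. -/
theorem Le.exists_step (h : Le p q) (hT : ¬ q.T ⊆ p.T) : ∃ m, ExtR p m ∧ Le m q := by
  have key : ∀ t ∈ q.T, t ∉ p.T →
      ∃ x ∈ q.T, x ∉ p.T ∧ ∀ v ∈ q.T, TransGen q.R v x → v ∈ p.T := by
    refine trans_induction fun t ht ih htp => ?_
    by_cases hall : ∀ v ∈ q.T, TransGen q.R v t → v ∈ p.T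
    · exact ⟨t, ht, htp, hall⟩
    · push Not at hall
      obtain ⟨v, hv, hvt, hvp⟩ := hall
      exact ih v hv hvt hvp
  obtain ⟨t, ht, htp⟩ := Set.not_subset.1 hT
  obtain ⟨x, hx, hxp, hall⟩ := key t ht htp
  obtain ⟨v, -, hv⟩ := q.lab_T x hx
  have hpre : q.pre x ⊆ p.C := by
    intro c hc
    have hcS := mem_S_of_pre hx hc
    by_cases hprod : ∃ w, q.R w c
    · obtain ⟨w, hw⟩ := hprod
      have hwp := hall w (mem_T_of_prod hcS hw) ((TransGen.single hw).tail hc)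
      exact mem_C_right (h.back hw (Or.inr hwp))
    · have : c ∈ q.I := ⟨hcS, fun w hw => hprod ⟨w, hw⟩⟩
      rw [← h.I_eq] at this
      exact Or.inl this.1
  obtain ⟨m, hm, hle⟩ := h.exists_ext hx hxp hpre hv
  exact ⟨m, ⟨x, v, _, hm⟩, hle⟩

theorem Le.chain (h : Le p q) (hq : q.T.Finite) : ReflTransGen ExtR p q := by
  induction hn : (q.T \ p.T).ncard using Nat.strong_induction_on generalizing p with
  | _ n ih =>
    by_cases hT : q.T ⊆ p.T
    · rw [h.eq_of_T_sub hT]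
    · obtain ⟨m, ⟨x, v, A, hm⟩, hle⟩ := h.exists_step hT
      refine (ih _ ?_ hle rfl).head ⟨x, v, A, hm⟩
      rw [← hn]
      refine Set.ncard_lt_ncard ⟨Set.sdiff_subset_sdiff_right hm.le.T_sub, fun hsub => ?_⟩ hq.sdiff
      exact (hsub ⟨hle.T_sub hm.mem_T, hm.notMem⟩).2 hm.mem_T

/-- The prefix without transitions. -/
noncomputable def bot (p : Proc N) : Proc N :=
  p.restrict ∅ (Set.empty_subset _) fun _ h => h.elim

theorem bot_le (p : Proc N) : Le p.bot p := restrict_le ..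

/-- Without transitions all places are initial, and `N.M₀` counts them by label, so a
label-preserving bijection is an isomorphism. -/
theorem bot_star (p q : Proc N) : Star p.bot q.bot := by
  have hT : ∀ r : Proc N, ∀ x, x ∉ r.bot.T := fun r x h => h
  have hR : ∀ r : Proc N, ∀ x y, ¬ r.bot.R x y := fun r x y h => h.2.elim id id
  have hI : ∀ r : Proc N, ∀ s, {x | x ∈ r.bot.S ∧ r.bot.lab x = some s}.encard = N.M₀ s := by
    intro r s
    rw [← r.bot.card_init s]
    congr 1
    ext x
    exact ⟨fun h => ⟨⟨h.1, fun t => hR r t x⟩, h.2⟩, fun h => ⟨h.1.1, h.2⟩⟩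
  have hl : ∀ r : Proc N, ∀ x ∈ r.bot.S, ∃ s, r.bot.lab x = some s := fun r x hx =>
    (r.bot.lab_S x hx).imp fun s hs => hs.2
  obtain ⟨φ, hφ, hφl⟩ := exists_bijOn_lab (hl p) (hl q) (hI p) (hI q)
  refine IsIso.star (φ := φ) ⟨hφ, ⟨?_, ?_, ?_⟩, ?_, ?_⟩
  · exact fun x hx => (hT p x hx).elim
  · exact fun x hx => (hT p x hx).elim
  · exact fun x hx => (hT q x hx).elim
  · exact fun x _ y _ => iff_of_false (hR q _ _) (hR p _ _)
  · exact fun x hx => hφl x (hx.resolve_right (hT p x))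

/-! ### Markings -/

/-- The marking `M` is the one reached at the end of `p`. -/
def Marks (p : Proc N) (M : U → ℕ) : Prop :=
  ∀ s, {x | x ∈ p.E ∧ p.lab x = some s}.encard = M s

theorem Ext.enabled {x v A} (h : Ext p q x v A) {M} (hM : p.Marks M) : N.Enabled M {v} := by
  refine ⟨by simp, by simpa using h.label_mem, fun s => ?_⟩
  have h1 : ((N.F s v : ℕ) : ℕ∞) ≤ M s := by
    rw [← h.card_eq s, ← hM s]
    exact Set.encard_le_encard fun a ha => ⟨h.sub_E ha.1, ha.2⟩
  simpa [Net.pre] using h1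

theorem Ext.marks {x v A} (h : Ext p q x v A) {M} (hM : p.Marks M) :
    q.Marks fun s => (M s - N.F s v) + N.F v s := by
  intro s
  have h1 : {y | y ∈ q.E ∧ q.lab y = some s} =
      ({y | y ∈ p.E ∧ p.lab y = some s} \ {a | a ∈ A ∧ p.lab a = some s}) ∪
        {y | y ∈ q.post x ∧ q.lab y = some s} := by
    ext y
    have hE : y ∈ q.E ↔ (y ∈ p.E ∧ y ∉ A) ∨ y ∈ q.post x := by rw [h.E_eq]; rfl
    constructor
    · rintro ⟨hy, hl⟩
      rcases hE.1 hy with hy | hy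
      · rw [h.le.lab_eq y (Or.inl hy.1.1)] at hl
        exact Or.inl ⟨⟨hy.1, hl⟩, fun ha => hy.2 ha.1⟩
      · exact Or.inr ⟨hy, hl⟩
    · rintro (⟨⟨hy, hl⟩, hy'⟩ | ⟨hy, hl⟩)
      · refine ⟨hE.2 (Or.inl ⟨hy, fun hA => hy' ⟨hA, hl⟩⟩), ?_⟩
        rw [h.le.lab_eq y (Or.inl hy.1)]
        exact hl
      · exact ⟨hE.2 (Or.inr hy), hl⟩
  have hsub : {a | a ∈ A ∧ p.lab a = some s} ⊆ {y | y ∈ p.E ∧ p.lab y = some s} :=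
    fun a ha => ⟨h.sub_E ha.1, ha.2⟩
  change _ = ((M s - N.F s v + N.F v s : ℕ) : ℕ∞)
  rw [h1, Set.encard_union_eq, h.card_post]
  · have h2 := Set.encard_sdiff_add_encard_of_subset hsub
    have hfin : {y | y ∈ p.E ∧ p.lab y = some s}.Finite := Set.finite_of_encard_eq_coe (hM s)
    rw [h.card_eq, hM s] at h2
    rw [← (hfin.sdiff (t := {a | a ∈ A ∧ p.lab a = some s})).cast_ncard_eq] at h2 ⊢
    norm_cast at h2 ⊢
    omega
  · rw [Set.disjoint_left]
    rintro y ⟨hy, -⟩ hy'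
    exact h.post_notMem hy'.1 (Or.inl hy.1.1)

/-- Building `p` one transition at a time is a firing sequence of `N`. This links the hypotheses on
reachable markings to processes. -/
theorem exists_marks (hp : p.T.Finite) : ∃ M, N.Reachable M ∧ p.Marks M := by
  have h := (bot_le p).chain hp
  have h0 : p.bot.Marks N.M₀ := by
    intro s
    rw [← p.bot.card_init s]
    congr 1
    ext x
    refine and_congr_left fun _ => and_congr_right fun _ => ?_
    exact iff_of_true (fun t h => h.2.elim id id) fun t h => h.2.elim id id
  clear hp
  generalize p.bot = b at h h0
  induction h with
  | refl => exact ⟨N.M₀, .refl, h0⟩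
  | tail _ h ih =>
    obtain ⟨M, hr, hM⟩ := ih
    obtain ⟨x, v, A, h⟩ := h
    refine ⟨_, hr.tail ⟨v, h.enabled hM, ?_⟩, h.marks hM⟩
    intro s
    simp [Net.pre, Net.post]

/-- The condition `v ≠ w` matters: only then are the restrictions of `{v, w}` single transitions.
Equal labels are treated by swapping instead. -/
theorem enabled_pair (hcf : N.ConflictFree) {M} (hM : N.Reachable M) {v w : U} (hvw : v ≠ w)
    (hv : N.Enabled M {v}) (hw : N.Enabled M {w}) : N.Enabled M {v, w} := by
  classical
  have hvT : v ∈ N.T := hv.2.1 v (by simp)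
  have hwT : w ∈ N.T := hw.2.1 w (by simp)
  by_contra hcon
  refine hcf {v, w} (by simp) ?_ M hM ⟨?_, hcon⟩
  · intro t ht
    simp only [Multiset.insert_eq_cons, Multiset.mem_cons, Multiset.mem_singleton] at ht
    rcases ht with rfl | rfl <;> assumption
  · intro t ht
    simp only [Multiset.insert_eq_cons, Multiset.mem_cons, Multiset.mem_singleton] at ht
    have h1 : onlyAt {v, w} v = {v} := by
      unfold onlyAt
      rw [Multiset.insert_eq_cons, Multiset.count_cons_self,
        Multiset.count_singleton, if_neg hvw]
      simp
    have h2 : onlyAt {v, w} w = {w} := by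
      unfold onlyAt
      rw [Multiset.insert_eq_cons, Multiset.count_cons_of_ne hvw.symm,
        Multiset.count_singleton_self]
      simp
    rcases ht with rfl | rfl
    · rwa [h1]
    · rwa [h2]

/-! ### Commuting extensions and absorbing them into a maximal process. -/

/-- Differently labelled extensions of a finite process can be combined. -/
theorem Ext.diamond (hcf : N.ConflictFree) (hsc : N.IsStructuralConflictNet) (hp : p.T.Finite)
    {x y : ZFSet.{u}} {v w : U} {A B : Set ZFSet.{u}} (hvw : v ≠ w) (h : Ext p q x v A)
    (h' : Ext p r y w B) : ∃ z x', Ext r z x' v A ∧ Sub q z := by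
  obtain ⟨M, hr, hM⟩ := exists_marks hp
  have hen := enabled_pair hcf hr hvw (h.enabled hM) (h'.enabled hM)
  have hmin := hsc v h.label_mem w h'.label_mem ⟨M, hr, hen⟩
  -- A place in both `A` and `B` would have as label a common preplace of `v` and `w`.
  have hA : A ⊆ r.E := by
    intro a ha
    rw [h'.E_eq]
    refine Or.inl ⟨h.sub_E ha, fun hb => ?_⟩
    obtain ⟨s, -, hs⟩ := p.lab_S a (h.sub_E ha).1
    have h1 := h.label_pos ha hs
    have h2 := h'.label_pos hb hs
    have h3 := hmin s
    omega
  obtain ⟨z, x', hz⟩ := r.exists_ext h.label_mem hA fun s => by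
    rw [← h.card_eq s]
    congr 1
    ext a
    refine and_congr_right fun ha => ?_
    rw [h'.le.lab_eq a (Or.inl (h.sub_E ha).1)]
  -- The preplaces of `x'` already lie in `p`, so `x'` can also be fired first; the resulting `q'`
  -- is equivalent to `q`, as both append `v` to `p`.
  obtain ⟨q', hq', hle⟩ := (h'.le.trans hz.le).exists_ext hz.mem_T
    (fun hx => hz.notMem (h'.le.T_sub hx))
    (by rw [hz.pre_eq]; exact fun a ha => Or.inl (h.sub_E ha).1) hz.lab_eq
  rw [hz.pre_eq] at hq'
  obtain ⟨m, h1, h2⟩ := (h.star hq').symm.lift_chain (hle.chain (hz.finite (h'.finite hp)))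
  exact ⟨z, x', hz, m, h1, h2.symm⟩

/-- An extension by a transition can be postponed past a chain of extensions. -/
theorem Ext.push (hcf : N.ConflictFree) (hsc : N.IsStructuralConflictNet) {w : Proc N} {v : U}
    {A : Set ZFSet.{u}} (hw : ReflTransGen ExtR p w) {x : ZFSet.{u}} (hp : p.T.Finite)
    (h : Ext p q x v A) : Sub q w ∨ ∃ z x', Ext w z x' v A ∧ Sub q z := by
  induction hw using ReflTransGen.head_induction_on generalizing q x with
  | refl => exact Or.inr ⟨q, x, h, .refl q⟩
  | @head p r hr hw ih =>
    obtain ⟨y, v', B, hr⟩ := hr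
    by_cases hv : v = v'
    · subst hv
      obtain ⟨m, h1, h2⟩ := (h.star hr).symm.lift_chain hw
      exact Or.inl ⟨m, h1, h2.symm⟩
    · obtain ⟨z, x', h1, h2⟩ := h.diamond hcf hsc hp hv hr
      rcases ih (hr.finite hp) h1 with h3 | ⟨z', x'', h3, h4⟩
      · exact Or.inl (h2.trans h3)
      · exact Or.inr ⟨z', x'', h3, h2.trans h4⟩

/-- If no finite prefix of `Q` absorbs the extension, then `Q` consumes no place of `A`, and `v` can
be appended to `Q` itself. -/
theorem Maximal.absorb (hcf : N.ConflictFree) (hsc : N.IsStructuralConflictNet) {Q : Proc N}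
    (hQ : Q.Maximal) {x : ZFSet.{u}} {v : U} {A : Set ZFSet.{u}} (hle : Le p Q) (hp : p.T.Finite)
    (h : Ext p q x v A) : ∃ w, Le w Q ∧ w.T.Finite ∧ Sub q w := by
  by_contra hcon
  have hE : A ⊆ Q.E := by
    intro a ha
    refine ⟨hle.S_sub (h.sub_E ha).1, fun t ht => ?_⟩
    have htT : t ∈ Q.T := mem_T_of_cons (hle.S_sub (h.sub_E ha).1) ht
    -- The least causally closed set containing `p.T` and the supposed consumer `t` of `a`. Pushing
    -- `v` along the finite prefix it spans leaves `a` unconsumed there, contradicting `t`.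
    let D := p.T ∪ insert t {s | s ∈ Q.T ∧ TransGen Q.R s t}
    have hD : D ⊆ Q.T := Set.union_subset hle.T_sub (Set.insert_subset htT fun s hs => hs.1)
    have htD : t ∈ D := Or.inr (Set.mem_insert t _)
    have hc : ∀ w ∈ D, ∀ s ∈ Q.T, TransGen Q.R s w → s ∈ D := by
      rintro w (hw | rfl | hw) s hs hsw
      · exact Or.inl (hle.closed w hw s hs hsw)
      · exact Or.inr (Or.inr ⟨hs, hsw⟩)
      · exact Or.inr (Or.inr ⟨hs, hsw.trans hw.2⟩)
    have hfin : D.Finite := hp.union ((Q.finite_past t htT).insert t)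
    have hpw := le_restrict hle hD hc Set.subset_union_left
    rcases h.push hcf hsc (hpw.chain hfin) hp with h1 | ⟨z, x', h1, -⟩
    · exact hcon ⟨_, restrict_le Q D hD hc, hfin, h1⟩
    · exact (h1.sub_E ha).2 t ⟨ht, Or.inr htD⟩
  obtain ⟨Q', x', h'⟩ := Q.exists_ext h.label_mem hE fun s => by
    rw [← h.card_eq s]
    congr 1
    ext a
    refine and_congr_right fun ha => ?_
    rw [hle.lab_eq a (Or.inl (h.sub_E ha).1)]
  exact h'.notMem (hQ Q' h'.le ▸ h'.mem_T)

/-- Every finite process is, up to swapping, a prefix of a finite prefix of any maximal process. -/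
theorem Maximal.exists_sub (hcf : N.ConflictFree) (hsc : N.IsStructuralConflictNet) {Q : Proc N}
    (hQ : Q.Maximal) (hp : p.T.Finite) : ∃ w, Le w Q ∧ w.T.Finite ∧ Sub p w := by
  have h := (bot_le p).chain hp
  have h0 : p.bot.T.Finite ∧ ∃ w, Le w Q ∧ w.T.Finite ∧ Sub p.bot w :=
    ⟨Set.finite_empty, Q.bot, bot_le Q, Set.finite_empty, (bot_star p Q).sub⟩
  clear hp
  generalize p.bot = b at h h0
  -- Finiteness of the intermediate processes is carried through the induction, since `Ext.push`
  -- requires it.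
  refine And.right (a := p.T.Finite) ?_
  induction h with
  | refl => exact h0
  | tail _ h ih =>
    obtain ⟨hbfin, w, hw, hfin, m, h1, h2⟩ := ih
    obtain ⟨x, v, A, h⟩ := h
    refine ⟨h.finite hbfin, ?_⟩
    -- The new transition is pushed past the chain to `m`; if it is not absorbed there, the
    -- extension of `m` is transported to the prefix `w` of `Q` and absorbed by maximality.
    rcases h.push hcf hsc h1 hbfin with h3 | ⟨z, x', h3, h4⟩
    · exact ⟨w, hw, hfin, h3.trans h2.sub⟩
    · obtain ⟨z', x'', A', h5, h6⟩ := h2.lift h3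
      obtain ⟨w', hw', hfin', h7⟩ := hQ.absorb hcf hsc hw hfin h5
      exact ⟨w', hw', hfin', (h4.trans h6.sub).trans h7⟩

end Proc

/-! ### From presentations to GR-processes. -/

namespace Proc

variable {U : Type u} {N : Net U} {p q : Proc N}

theorem pos_ite {P : Prop} [Decidable P] : 0 < (if P then 1 else 0) ↔ P := by
  split_ifs with h <;> simp [h]

open Classical in
/-- The net underlying a process. -/
noncomputable def toNet (p : Proc N) : Net ZFSet.{u} where
  S := p.S
  T := p.T
  F x y := if p.R x y then 1 else 0
  M₀ x := if x ∈ p.I then 1 else 0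
  disjoint := Set.disjoint_left.2 p.disj
  F_support x y h := p.supp (pos_ite.1 (Nat.pos_of_ne_zero h))
  M₀_support x h := (pos_ite.1 (Nat.pos_of_ne_zero h)).1
  pre_finite t ht := by
    simp only [pos_ite]
    exact pre_finite ht
  pre_nonempty t ht := by
    simp only [pos_ite]
    exact pre_nonempty ht
  post_finite t ht := by
    simp only [pos_ite]
    exact post_finite ht

theorem toNet_pos {x y} : 0 < p.toNet.F x y ↔ p.R x y := by
  classical
  exact pos_ite

theorem toNet_M₀_pos {x} : 0 < p.toNet.M₀ x ↔ x ∈ p.I := by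
  classical
  exact pos_ite

theorem toNet_FPlus : p.toNet.FPlus = TransGen p.R := by
  have : (fun x y => 0 < p.toNet.F x y) = p.R := by
    ext x y
    exact toNet_pos
  rw [Net.FPlus, this]

theorem isSome_lab (x : ↥(p.S ∪ p.T)) : (p.lab x.1).isSome :=
  Option.isSome_iff_ne_none.2 (mem_C_iff.1 x.2)

theorem encard_subtype {C : Set ZFSet.{u}} {lab : ZFSet.{u} → Option U} {π : C → U}
    (hπ : ∀ x, lab x.1 = some (π x)) {P : ZFSet.{u} → Prop} (hP : ∀ x, P x → x ∈ C) (s : U) :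
    {x : C | π x = s ∧ P x}.encard = {x | P x ∧ lab x = some s}.encard := by
  rw [← Subtype.val_injective.encard_image]
  congr 1
  ext x
  constructor
  · rintro ⟨x, ⟨h1, h2⟩, rfl⟩
    exact ⟨h2, (hπ x).trans (congrArg some h1)⟩
  · rintro ⟨h1, h2⟩
    refine ⟨⟨x, hP x h1⟩, ⟨?_, h1⟩, rfl⟩
    have := hπ ⟨x, hP x h1⟩
    rw [h2, Option.some_inj] at this
    exact this.symm

/-- The GR-process presented by `p`. -/
noncomputable def toGR (p : Proc N) : GRProcess N where
  net := p.toNet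
  small_S := p.small_S
  small_T := p.small_T
  pre_place s hs := by
    classical
    refine ⟨fun t => ?_, fun t ht t' ht' => ?_⟩
    · change (if p.R t s then 1 else 0) ≤ 1
      split_ifs <;> simp
    · exact p.prod_unique s hs t t' (toNet_pos.1 ht) (toNet_pos.1 ht')
  post_place s hs := by
    classical
    refine ⟨fun t => ?_, fun t ht t' ht' => ?_⟩
    · change (if p.R s t then 1 else 0) ≤ 1
      split_ifs <;> simp
    · exact p.cons_unique s hs t t' (toNet_pos.1 ht) (toNet_pos.1 ht')
  init s hs := by
    classical
    change (if s ∈ p.I then 1 else 0) = _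
    refine if_congr ?_ rfl rfl
    refine (and_iff_right hs).trans (forall_congr' fun t => ?_)
    rw [← toNet_pos, Nat.pos_iff_ne_zero, not_not]
  acyclic x h := p.acyclic x (toNet_FPlus ▸ h)
  finite_past v hv := by
    rw [toNet_FPlus]
    exact p.finite_past v hv
  π x := (p.lab x.1).get (isSome_lab x)
  π_place x hx := by
    obtain ⟨s, hs, h⟩ := p.lab_S x.1 hx
    simpa [h] using hs
  π_trans x hx := by
    obtain ⟨s, hs, h⟩ := p.lab_T x.1 hx
    simpa [h] using hs
  π_init s _ := by
    rw [← p.card_init s]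
    refine Eq.trans ?_ (encard_subtype (P := fun x => 0 < p.toNet.M₀ x) (lab := p.lab)
      (fun x => (Option.some_get (isSome_lab x)).symm) (fun x hx => ?_) s).symm
    · congr 1
      ext x
      exact and_congr_left fun _ => toNet_M₀_pos.symm
    · exact Or.inl (toNet_M₀_pos.1 hx).1
  π_pre t ht s _ := by
    rw [← p.card_pre t.1 ht _ (Option.some_get (isSome_lab t)).symm s]
    refine Eq.trans ?_ (encard_subtype (P := fun x => 0 < p.toNet.F x t) (lab := p.lab)
      (fun x => (Option.some_get (isSome_lab x)).symm) (fun x hx => ?_) s).symm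
    · simp only [toNet_pos]
    · exact mem_C_left (toNet_pos.1 hx)
  π_post t ht s _ := by
    rw [← p.card_post t.1 ht _ (Option.some_get (isSome_lab t)).symm s]
    refine Eq.trans ?_ (encard_subtype (P := fun x => 0 < p.toNet.F t x) (lab := p.lab)
      (fun x => (Option.some_get (isSome_lab x)).symm) (fun x hx => ?_) s).symm
    · simp only [toNet_pos]
    · exact mem_C_right (toNet_pos.1 hx)

end Proc

/-! ### From GR-processes to presentations. -/

namespace GRProcess

variable {U : Type u} {N : Net U} (P Q : GRProcess N)

open Classical in
/-- The labelling of a GR-process as a partial function. -/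
noncomputable def lab (x : ZFSet.{u}) : Option U :=
  if h : x ∈ P.net.S ∪ P.net.T then some (P.π ⟨x, h⟩) else none

variable {P Q}

theorem lab_eq (x : ↥(P.net.S ∪ P.net.T)) : P.lab x.1 = some (P.π x) := dif_pos x.2

theorem M₀_pos {x} : 0 < P.net.M₀ x ↔ x ∈ P.net.S ∧ ∀ t, ¬ 0 < P.net.F t x := by
  classical
  by_cases hx : x ∈ P.net.S
  · rw [P.init x hx, Proc.pos_ite]
    simp [hx]
  · simp only [hx, false_and, iff_false, not_lt, Nat.le_zero]
    by_contra h
    exact hx (P.net.M₀_support x h)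

theorem exists_label_place {x} (hx : x ∈ P.net.S) : ∃ s ∈ N.S, P.lab x = some s :=
  ⟨_, P.π_place ⟨x, Or.inl hx⟩ hx, lab_eq ⟨x, Or.inl hx⟩⟩

/-- GR-processes fix the counts only for labels in `N.S`. Elsewhere both sides vanish, because
labels of places lie in `N.S`. -/
theorem encard_label {X : ZFSet.{u} → Prop} (hX : ∀ x, X x → x ∈ P.net.S) {f : U → ℕ}
    (hf : ∀ s, f s ≠ 0 → s ∈ N.S)
    (h : ∀ s ∈ N.S, (f s : ℕ∞) = {x : ↥(P.net.S ∪ P.net.T) | P.π x = s ∧ X x}.encard) (s : U) :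
    {x | X x ∧ P.lab x = some s}.encard = f s := by
  by_cases hs : s ∈ N.S
  · rw [h s hs]
    exact (Proc.encard_subtype (lab_eq (P := P)) (fun x hx => Or.inl (hX x hx)) s).symm
  · have h0 : f s = 0 := by_contra fun h => hs (hf s h)
    rw [h0, Nat.cast_zero, Set.encard_eq_zero]
    refine Set.eq_empty_of_forall_notMem ?_
    rintro x ⟨hx, hl⟩
    obtain ⟨s', hs', hl'⟩ := exists_label_place (hX x hx)
    rw [hl, Option.some_inj] at hl'
    exact hs (hl' ▸ hs')

theorem place_of_pre {x t} (ht : t ∈ P.net.T) (h : 0 < P.net.F x t) : x ∈ P.net.S := by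
  rcases P.net.F_support x t h.ne' with h | h
  · exact h.1
  · exact absurd ht (Set.disjoint_left.1 P.net.disjoint h.2)

theorem place_of_post {x t} (ht : t ∈ P.net.T) (h : 0 < P.net.F t x) : x ∈ P.net.S := by
  rcases P.net.F_support t x h.ne' with h | h
  · exact absurd ht (Set.disjoint_left.1 P.net.disjoint h.1)
  · exact h.2

theorem label_trans {t} (ht : t ∈ P.net.T) {v} (hv : P.lab t = some v) :
    v ∈ N.T ∧ P.π ⟨t, Or.inr ht⟩ = v := by
  have h := lab_eq (P := P) ⟨t, Or.inr ht⟩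
  rw [hv, Option.some_inj] at h
  exact ⟨h ▸ P.π_trans ⟨t, Or.inr ht⟩ ht, h.symm⟩

variable (P) in
/-- The presentation of a GR-process. -/
noncomputable def toProc : Proc N where
  S := P.net.S
  T := P.net.T
  R x y := 0 < P.net.F x y
  lab := P.lab
  disj x hx hx' := Set.disjoint_left.1 P.net.disjoint hx hx'
  supp h := P.net.F_support _ _ h.ne'
  lab_S _ := exists_label_place
  lab_T x hx := ⟨_, P.π_trans ⟨x, Or.inr hx⟩ hx, lab_eq ⟨x, Or.inr hx⟩⟩
  lab_none x hx hx' := dif_neg fun h => h.elim hx hx'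
  prod_unique s hs t t' h h' := (P.pre_place s hs).2 h h'
  cons_unique s hs t t' h h' := (P.post_place s hs).2 h h'
  acyclic := P.acyclic
  finite_past := P.finite_past
  card_init := by
    refine encard_label (fun x hx => hx.1) (fun s => N.M₀_support s) fun s hs => ?_
    rw [P.π_init s hs]
    simp only [M₀_pos]
  card_pre t ht v hv := by
    obtain ⟨hvT, hπ⟩ := label_trans ht hv
    refine encard_label (fun x hx => place_of_pre ht hx) (fun s hs => ?_) fun s hs => ?_
    · rcases N.F_support _ _ hs with h | h
      · exact h.1
      · exact absurd hvT (Set.disjoint_left.1 N.disjoint h.2)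
    · rw [← hπ, P.π_pre ⟨t, Or.inr ht⟩ ht s hs]
  card_post t ht v hv := by
    obtain ⟨hvT, hπ⟩ := label_trans ht hv
    refine encard_label (fun x hx => place_of_post ht hx) (fun s hs => ?_) fun s hs => ?_
    · exact Proc.flow_zero_of_notMem hvT hs
    · rw [← hπ, P.π_post ⟨t, Or.inr ht⟩ ht s hs]

theorem F_le_one (x y) : P.net.F x y ≤ 1 := by
  by_contra h
  rcases P.net.F_support x y (by omega) with h' | h'
  · exact h ((P.post_place x h'.1).1 y)
  · exact h ((P.pre_place y h'.2).1 x)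

theorem toGR_toProc (P : GRProcess N) : P.toProc.toGR = P := by
  classical
  refine Proc.ext_gr rfl rfl ?_ ?_ ?_
  · ext x y
    change (if P.toProc.R x y then 1 else 0) = _
    have h1 := F_le_one (P := P) x y
    have h2 : P.toProc.R x y ↔ 0 < P.net.F x y := Iff.rfl
    by_cases h : 0 < P.net.F x y
    · rw [if_pos (h2.2 h)]
      omega
    · rw [if_neg fun h' => h (h2.1 h')]
      omega
  · ext x
    change (if x ∈ P.toProc.I then 1 else 0) = _
    by_cases h : 0 < P.net.M₀ x
    · rw [if_pos (show x ∈ P.toProc.I from M₀_pos.1 h)]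
      have h1 := (M₀_pos.1 h).1
      rw [P.init x h1] at h ⊢
      exact (if_pos (Proc.pos_ite.1 h)).symm
    · rw [if_neg (show x ∉ P.toProc.I from fun h' => h (M₀_pos.2 h'))]
      omega
  · intro x h h'
    have h1 : P.lab x = some (P.π ⟨x, h'⟩) := lab_eq ⟨x, h'⟩
    exact Option.get_of_eq_some _ h1

theorem toProc_toGR (p : Proc N) : p.toGR.toProc = p := by
  refine Proc.ext rfl rfl ?_ ?_
  · ext x y
    exact Proc.toNet_pos
  · ext1 x
    by_cases hx : x ∈ p.C
    · exact (lab_eq (P := p.toGR) ⟨x, hx⟩).trans (Option.some_get _)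
    · exact (dif_neg hx).trans (not_not.1 (fun h => hx (Proc.mem_C_iff.2 h))).symm

end GRProcess

/-! ### Transfer of prefixes and swaps. -/

namespace Proc

variable {U : Type u} {N : Net U} {p q : Proc N}

/-- The prefix order on GR-processes compares only arcs between elements of the prefix. That `q`
adds no arcs at transitions of `p` follows from equal finite counts; at places it follows from
uniqueness of producers and from `hI`. -/
theorem Le.of_sub (hS : p.S ⊆ q.S) (hT : p.T ⊆ q.T) (hl : ∀ x ∈ p.C, q.lab x = p.lab x)
    (hR : ∀ {x y}, p.R x y → q.R x y) (hI : p.I ⊆ q.I) : Le p q where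
  S_sub := hS
  T_sub := hT
  lab_eq := hl
  R_sub := hR
  back := by
    have hlT : ∀ t ∈ p.T, ∃ v, p.lab t = some v ∧ q.lab t = some v := by
      intro t ht
      obtain ⟨v, -, hv⟩ := p.lab_T t ht
      exact ⟨v, hv, (hl t (Or.inr ht)).trans hv⟩
    rintro x y hxy ((hy | hy) | hx)
    · by_cases hprod : ∃ t, p.R t y
      · obtain ⟨t, ht⟩ := hprod
        exact q.prod_unique y (hS hy) _ _ hxy (hR ht) ▸ ht
      · exact absurd hxy ((hI ⟨hy, fun t ht => hprod ⟨t, ht⟩⟩).2 x)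
    · obtain ⟨v, h1, h2⟩ := hlT y hy
      obtain ⟨s, -, hs⟩ := q.lab_S x (mem_S_of_pre (hT hy) hxy)
      have hfin : {x | p.R x y ∧ p.lab x = some s}.Finite :=
        Set.finite_of_encard_eq_coe (p.card_pre y hy v h1 s)
      have heq := hfin.eq_of_subset_of_encard_le (t := {x | q.R x y ∧ q.lab x = some s})
        (fun z hz => ⟨hR hz.1, (hl z (mem_C_left hz.1)).trans hz.2⟩)
        ((q.card_pre y (hT hy) v h2 s).trans (p.card_pre y hy v h1 s).symm).le
      exact ((Set.ext_iff.1 heq x).2 ⟨hxy, hs⟩).1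
    · obtain ⟨v, h1, h2⟩ := hlT x hx
      obtain ⟨s, -, hs⟩ := q.lab_S y (mem_S_of_post (hT hx) hxy)
      have hfin : {y | p.R x y ∧ p.lab y = some s}.Finite :=
        Set.finite_of_encard_eq_coe (p.card_post x hx v h1 s)
      have heq := hfin.eq_of_subset_of_encard_le (t := {y | q.R x y ∧ q.lab y = some s})
        (fun z hz => ⟨hR hz.1, (hl z (mem_C_right hz.1)).trans hz.2⟩)
        ((q.card_post x (hT hx) v h2 s).trans (p.card_post x hx v h1 s).symm).le
      exact ((Set.ext_iff.1 heq y).2 ⟨hxy, hs⟩).1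

theorem Le.toGR_prefix (h : Le p q) : p.toGR.Prefix q.toGR := by
  classical
  refine ⟨h.S_sub, h.T_sub, ?_, ?_, ?_⟩
  · ext x
    change (if x ∈ p.I then 1 else 0) = if x ∈ q.I then 1 else 0
    rw [h.I_eq]
  · intro x y hxy
    change (if p.R x y then 1 else 0) = if q.R x y then 1 else 0
    refine if_congr ⟨h.R_sub, fun hR => h.back hR ?_⟩ rfl rfl
    exact hxy.imp (fun h => Or.inr h.2) fun h => h.1
  · intro x hx hx'
    have hl := h.lab_eq x hx
    change (p.lab x).get _ = (q.lab x).get _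
    simp only [hl]

theorem OneStep.toGR (h : OneStep p q) : p.toGR.OneStepSwapEquiv q.toGR := by
  classical
  obtain ⟨a, b, h, φ, hφ⟩ := h
  refine ⟨a, b, (p.swap h).toGR, ⟨h.ha, h.hb, ?_, ?_, ?_, rfl, rfl, ?_, ?_, ?_⟩, ?_⟩
  · exact fun h' => h.hab (toNet_FPlus (p := p) ▸ h')
  · exact fun h' => h.hba (toNet_FPlus (p := p) ▸ h')
  · intro hp hq
    have hl := h.hl
    change (p.lab a).get _ = (p.lab b).get _
    simp only [hl]
  · ext x
    change (if x ∈ (p.swap h).I then 1 else 0) = if x ∈ p.I then 1 else 0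
    refine if_congr (and_congr_right fun hx => forall_congr' fun t => not_congr ?_) rfl rfl
    constructor
    · intro ht
      exact ((swap_supp h.ha h.hb ht).resolve_left fun h => p.disj x hx h.2).2.2
    · intro ht
      change p.R (Equiv.swap a b t) x
      rwa [swap_of_mem_T h.ha h.hb (mem_T_of_prod hx ht)]
  · exact fun _ _ _ => rfl
  · intro x y
    change (if p.R (Equiv.swap a b x) y then 1 else 0) =
      if x = a ∧ y ∈ p.T then (if p.R b y then 1 else 0) else
      if x = b ∧ y ∈ p.T then (if p.R a y then 1 else 0) else if p.R x y then 1 else 0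
    by_cases hy : y ∈ p.T
    · by_cases hxa : x = a
      · subst hxa
        simp [hy]
      by_cases hxb : x = b
      · subst hxb
        simp [hy, hxa]
      have h1 : ¬ (x = a ∧ y ∈ p.T) := fun h => hxa h.1
      have h2 : ¬ (x = b ∧ y ∈ p.T) := fun h => hxb h.1
      rw [Equiv.swap_apply_of_ne_of_ne hxa hxb, if_neg h1, if_neg h2]
    · have h1 : ¬ (x = a ∧ y ∈ p.T) := fun h => hy h.2
      have h2 : ¬ (x = b ∧ y ∈ p.T) := fun h => hy h.2
      rw [if_neg h1, if_neg h2]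
      refine if_congr ⟨fun hR => ?_, fun hR => ?_⟩ rfl rfl
      · exact ((swap_supp h.ha h.hb hR).resolve_left fun h => hy h.2).2.2
      · have hx := ((p.supp hR).resolve_left fun h => hy h.2).1
        rwa [swap_of_mem_T h.ha h.hb hx]
  · refine ⟨hφ.bijC.equiv, ?_, ?_, ?_, ?_⟩
    · intro x
      refine ⟨⟨fun hx => hφ.bijS.mapsTo hx, fun hx => ?_⟩,
        ⟨fun hx => hφ.bijT.mapsTo hx, fun hx => ?_⟩⟩
      · exact x.2.resolve_right fun hxT => q.disj _ hx (hφ.bijT.mapsTo hxT)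
      · exact x.2.resolve_left fun hxS => q.disj _ (hφ.bijS.mapsTo hxS) hx
    · intro x
      change (if φ x ∈ q.I then 1 else 0) = if x.1 ∈ (p.swap h).I then 1 else 0
      refine if_congr ⟨fun hx => ⟨?_, fun t ht => ?_⟩, fun hx => ⟨?_, fun t ht => ?_⟩⟩ rfl rfl
      · exact x.2.resolve_right fun hxT => q.disj _ hx.1 (hφ.bijT.mapsTo hxT)
      · exact hx.2 _ ((hφ.rel t (mem_C_left ht) x x.2).2 ht)
      · exact hφ.bijS.mapsTo hx.1
      · obtain ⟨w, hw, rfl⟩ := hφ.bijC.surjOn (mem_C_left ht)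
        exact hx.2 w ((hφ.rel w hw x x.2).1 ht)
    · intro x y
      exact if_congr (hφ.rel x x.2 y y.2) rfl rfl
    · intro x
      have hl := hφ.lab x x.2
      change ((p.swap h).lab x.1).get _ = (q.lab (φ x.1)).get _
      simp only [hl]

theorem Star.toGR (h : Star p q) : p.toGR.SwapStar q.toGR := by
  induction h with
  | refl => exact .refl
  | tail _ h ih => exact ih.tail h.toGR

end Proc

/-! ### Maximality and the finite approximations of a maximal process. -/

namespace GRProcess

variable {U : Type u} {N : Net U} {P Q : GRProcess N}

theorem Prefix.toProc_le (h : P.Prefix Q) : Proc.Le P.toProc Q.toProc := by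
  obtain ⟨hS, hT, hM, hF, hπ⟩ := h
  refine .of_sub hS hT ?_ ?_ ?_
  · intro x hx
    have hx' : x ∈ Q.net.S ∪ Q.net.T := Set.union_subset_union hS hT hx
    refine (lab_eq ⟨x, hx'⟩).trans (Eq.trans ?_ (lab_eq ⟨x, hx⟩).symm)
    rw [hπ x hx hx']
  · intro x y hxy
    have hxy : 0 < P.net.F x y := hxy
    rwa [hF x y (P.net.F_support x y hxy.ne')] at hxy
  · intro x hx
    have h1 : 0 < P.net.M₀ x := M₀_pos.2 hx
    rw [hM] at h1
    exact M₀_pos.1 h1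

theorem IsMaximal.toProc (h : P.IsMaximal) : P.toProc.Maximal := by
  intro q hq
  have h1 := hq.toGR_prefix
  rw [toGR_toProc] at h1
  have h2 : q.toGR = P := by_contra fun hne => h ⟨_, h1, hne⟩
  rw [← h2, toProc_toGR]

theorem isMaximal_toGR {p : Proc N} (h : p.Maximal) : p.toGR.IsMaximal := by
  rintro ⟨Q, hQ, hne⟩
  have h1 := hQ.toProc_le
  rw [toProc_toGR] at h1
  rw [← h _ h1, toGR_toProc] at hne
  exact hne rfl

/-- For a maximal process, `BD` consists of the classes of all finite processes. -/
theorem IsMaximal.BD_eq (hcf : N.ConflictFree) (hsc : N.IsStructuralConflictNet)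
    (h : P.IsMaximal) : P.BD = {A | ∃ X : GRProcess N, X.IsFinite ∧ A = X.swapClass} := by
  ext A
  constructor
  -- Finiteness is built into `ClassPrefix`, so this inclusion needs no maximality.
  · rintro ⟨B, -, X, -, hX, -, hA, -⟩
    exact ⟨X, hX, hA⟩
  · rintro ⟨X, hX, rfl⟩
    obtain ⟨w, hw, hfin, m, h1, h2⟩ := h.toProc.exists_sub hcf hsc (p := X.toProc) hX
    have hwP := hw.toGR_prefix
    rw [toGR_toProc] at hwP
    have hm := (Proc.chain_le h1).toGR_prefix
    rw [toGR_toProc] at hm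
    exact ⟨_, ⟨w.toGR, hwP, hfin, rfl⟩, X, w.toGR, hX, hfin, rfl, rfl, X, m.toGR, .refl, hm,
      h2.toGR⟩

end GRProcess

end PT

theorem mainTheorem2 {U : Type u} (N : PT.Net U)
    (hcf : N.ConflictFree) (hsc : N.IsStructuralConflictNet) :
    (∃! B : PT.BDProcess N, B.WeaklyMaximal) ∧
    ∃ P : PT.GRProcess N, P.IsMaximal ∧
      ∀ Q : PT.GRProcess N, Q.IsMaximal → Q.SwapEquiv P := by
  obtain ⟨p, hp⟩ := PT.Proc.exists_maximal N
  have hP := PT.GRProcess.isMaximal_toGR hp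
  have hQ : ∀ Q : PT.GRProcess N, Q.IsMaximal → Q.SwapEquiv p.toGR := fun Q hQ =>
    (hQ.BD_eq hcf hsc).trans (hP.BD_eq hcf hsc).symm
  refine ⟨⟨PT.BDProcess.mk p.toGR, ⟨p.toGR, rfl, hP⟩, ?_⟩, p.toGR, hP, hQ⟩
  rintro _ ⟨Q, rfl, hm⟩
  exact Quotient.sound (hQ Q hm)
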